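/- **Setting.** Let $A:[0,1]\to\mathbb R^{n\times n}$ and $B:[0,1]\to\mathbb R^{n\times m}$ be continuous, let $b_i$ be the $i$-th column of $B$, let $\varphi:\mathbb R^{n}\times\mathbb R^n\to\mathbb R^r$ be affine with at least one zero, and let $\underline a_i,\overline a_i:[0,1]\to\mathbb R$ be continuous with $\underline a_i(t)<\overline a_i(t)$ for all $t\in[0,1]$, $i=1,\dots,m$. Put $$\mathcal A=\{u\in L^2([0,1];\mathbb R^m) : \exists x\in W^{1,2}([0,1];\mathbb R^n),\ \dot x=Ax+Bu \text{ a.e. on } [0,1],\ \varphi(x(0),x(1))=0\},$$ $$\mathcal B=\{u\in L^2([0,1];\mathbb R^m) : \underline a_i(t)\le u_i(t)\le\overline a_i(t)\text{ for a.e. }t\in[0,1],\ i=1,\dots,m\}.$$ The system $\dot x=Ax+Bu$ is *controllable* on $[t_0,t_1]$ if every initial state $x(t_0)=x_0$ can be steered to $x(t_1)=0$ by a continuous control $u$; it is *controllable with respect to $u_i$* on $[t_0,t_1]$ if the same holds for $\dot x=Ax+b_iu_i$ with a continuous scalar control $u_i$. Assume that $\dot x=Ax+Bu$ is controllable on $[0,1]$.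 Consider the problem $$\text{(Pf)}\qquad \min\ \tfrac12\int_0^1\|v(t)\|_2^2\,dt\quad\text{over } v,u_{\mathcal B}\in L^2([0,1];\mathbb R^m)\text{ with } v+u_{\mathcal B}\in\mathcal A,\ u_{\mathcal B}\in\mathcal B .$$ **Theorem (Gap vector and the best approximation control in $\mathcal B$).** Suppose $\mathcal A\cap\mathcal B=\emptyset$. Then (Pf) has a solution, and the component $v$ (the optimal gap vector) is the same for all solutions. Moreover, for every solution $(v,u_{\mathcal B})$ of (Pf): 1. There is $\lambda:[0,1]\to\mathbb R^n$ with $\dot\lambda(t)=-A(t)^T\lambda(t)$ for all $t\in[0,1]$ such that $v=-B^T\lambda$ in $L^2$; that is, $t\mapsto -B(t)^T\lambda(t)$ is the continuous representative of $v$. 2. Let $i\in\{1,\dots,m\}$ be such that the system is controllable with respect to $u_i$ on every $[t',t'']\subset[0,1]$ with $t'<t''$. (a) For a.e. $t\in[0,1]$, $u_{\mathcal B,i}(t)=\overline a_i(t)$ if $v_i(t)>0$ and $u_{\mathcal B,i}(t)=\underline a_i(t)$ if $v_i(t)<0$; and there is no singular interval, i.e. $v_i$ does not vanish a.e. on any $[t',t'']\subset[0,1]$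 with $t'<t''$. (b) If in addition $A$ and $B$ are real-analytic on $[0,1]$, then $u_{\mathcal B,i}$ is of bang–bang type on $[0,1]$: $v_i(t)\neq0$ for a.e. $t\in[0,1]$, and for a.e. $t\in[0,1]$ $$u_{\mathcal B,i}(t)=\begin{cases}\overline a_i(t), & v_i(t)\ge 0,\\ \underline a_i(t), & v_i(t)<0.\end{cases}$$ -/

import Mathlib

open Set Filter MeasureTheory
open scoped ENNReal Matrix

noncomputable section

namespace BestApprox

/-- The Hilbert space `L²([0,1]; ℝᵐ)` of controls, with the Euclidean norm on `ℝᵐ`. -/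
abbrev Control (m : ℕ) : Type :=
  Lp (EuclideanSpace ℝ (Fin m)) 2 ((volume : Measure ℝ).restrict (Icc (0 : ℝ) 1))

/-- `x ∈ W^{1,2}([0,1]; ℝⁿ)`, in terms of the continuous representative: `x` is absolutely
continuous on `[0,1]` and its (almost everywhere defined) derivative is square integrable. -/
def IsW12 {n : ℕ} (x : ℝ → Fin n → ℝ) : Prop :=
  AbsolutelyContinuousOnInterval x 0 1 ∧
    MemLp (deriv x) 2 ((volume : Measure ℝ).restrict (Icc (0 : ℝ) 1))

/-- The set `𝓐` of the controls `u ∈ L²` for which `ẋ = A x + B u` a.e. on `[0,1]`,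
`φ (x 0, x 1) = 0` has a solution `x ∈ W^{1,2}`. -/
def affineSet {n m r : ℕ} (A : ℝ → Matrix (Fin n) (Fin n) ℝ) (B : ℝ → Matrix (Fin n) (Fin m) ℝ)
    (φ : ((Fin n → ℝ) × (Fin n → ℝ)) →ᵃ[ℝ] (Fin r → ℝ)) : Set (Control m) :=
  {u | ∃ x : ℝ → Fin n → ℝ, IsW12 x ∧
    (∀ᵐ t ∂(volume : Measure ℝ).restrict (Icc (0 : ℝ) 1),
      HasDerivAt x (A t *ᵥ x t + B t *ᵥ WithLp.ofLp (u t)) t) ∧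
    φ (x 0, x 1) = 0}

/-- The box `𝓑` of the controls `u ∈ L²` with `lo ≤ u ≤ hi` a.e. on `[0,1]`. -/
def box {m : ℕ} (lo hi : Fin m → ℝ → ℝ) : Set (Control m) :=
  {u | ∀ᵐ t ∂(volume : Measure ℝ).restrict (Icc (0 : ℝ) 1),
    ∀ i, lo i t ≤ u t i ∧ u t i ≤ hi i t}

/-- `(v, uB)` is feasible for Problem (Pf): the control `v + uB` steers the system so that the
boundary conditions hold, and `uB` satisfies the bounds. -/
def IsFeasiblePf {n m r : ℕ} (A : ℝ → Matrix (Fin n) (Fin n) ℝ)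
    (B : ℝ → Matrix (Fin n) (Fin m) ℝ)
    (φ : ((Fin n → ℝ) × (Fin n → ℝ)) →ᵃ[ℝ] (Fin r → ℝ)) (lo hi : Fin m → ℝ → ℝ)
    (v uB : Control m) : Prop :=
  v + uB ∈ affineSet A B φ ∧ uB ∈ box lo hi

/-- The objective `½ ∫₀¹ ‖v(t)‖₂² dt` of Problem (Pf). -/
def costPf {m : ℕ} (v : Control m) : ℝ :=
  (1 / 2 : ℝ) * ∫ t in Icc (0 : ℝ) 1, ‖v t‖ ^ 2

/-- `(v, uB)` is a (global) solution of Problem (Pf). -/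
def IsSolutionPf {n m r : ℕ} (A : ℝ → Matrix (Fin n) (Fin n) ℝ)
    (B : ℝ → Matrix (Fin n) (Fin m) ℝ)
    (φ : ((Fin n → ℝ) × (Fin n → ℝ)) →ᵃ[ℝ] (Fin r → ℝ)) (lo hi : Fin m → ℝ → ℝ)
    (v uB : Control m) : Prop :=
  IsFeasiblePf A B φ lo hi v uB ∧
    ∀ w uB' : Control m, IsFeasiblePf A B φ lo hi w uB' → costPf v ≤ costPf w

/-- `ẋ = A x + B u` is controllable on `[t₀, t₁]`: every initial state can be steered to `0`
by a continuous control. -/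
def ControllableOn {n m : ℕ} (A : ℝ → Matrix (Fin n) (Fin n) ℝ)
    (B : ℝ → Matrix (Fin n) (Fin m) ℝ) (t₀ t₁ : ℝ) : Prop :=
  ∀ x₀ : Fin n → ℝ, ∃ (u : ℝ → Fin m → ℝ) (x : ℝ → Fin n → ℝ),
    ContinuousOn u (Icc t₀ t₁) ∧ x t₀ = x₀ ∧
    (∀ t ∈ Icc t₀ t₁, HasDerivWithinAt x (A t *ᵥ x t + B t *ᵥ u t) (Icc t₀ t₁) t) ∧
    x t₁ = 0

/-- The system is controllable with respect to `u_i` on `[t₀, t₁]`: every initial state of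
`ẋ = A x + b_i u_i`, where `b_i` is the `i`-th column of `B`, can be steered to `0` by a
continuous scalar control. -/
def ControllableWrtOn {n m : ℕ} (A : ℝ → Matrix (Fin n) (Fin n) ℝ)
    (B : ℝ → Matrix (Fin n) (Fin m) ℝ) (i : Fin m) (t₀ t₁ : ℝ) : Prop :=
  ∀ x₀ : Fin n → ℝ, ∃ (w : ℝ → ℝ) (x : ℝ → Fin n → ℝ),
    ContinuousOn w (Icc t₀ t₁) ∧ x t₀ = x₀ ∧
    (∀ t ∈ Icc t₀ t₁,
      HasDerivWithinAt x (A t *ᵥ x t + w t • (B t).col i) (Icc t₀ t₁) t) ∧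
    x t₁ = 0

/-- `p` solves the adjoint equation `ṗ = -Aᵀ p` on `[0,1]`. -/
def SolvesAdjoint {n : ℕ} (A : ℝ → Matrix (Fin n) (Fin n) ℝ) (p : ℝ → Fin n → ℝ) : Prop :=
  ∀ t ∈ Icc (0 : ℝ) 1, HasDerivWithinAt p (-((A t)ᵀ *ᵥ p t)) (Icc (0 : ℝ) 1) t

end BestApprox

end

/-! Let `Y` be the fundamental matrix of the adjoint equation and `g j` the control `Bᵀ Y e_j`.
Along a trajectory the derivative of `(Y e_j) ⬝ᵥ x` is `(Y e_j) ⬝ᵥ B u`, so `⟪g j, u⟫` is the `j`-th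
entry of `Y(1)ᵀ x(1) - x(0)`. Hence `𝓐` is the preimage of an affine subspace `S` under the
finite-rank map `M u = (⟪g j, u⟫)_j` (`IsAdjointOutput.mem_affineSet_iff`), and (Pf) projects `0`
onto `D = {w | ∃ b ∈ 𝓑, M (w + b) ∈ S}`. This set is convex, nonempty because controllability makes
`M` onto, and closed because `M '' 𝓑` is compact (`isClosed_preimage_sub`). So the projection `v`
exists, is unique, and satisfies `⟪v, w - v⟫ ≥ 0` on `D`.

Two variations exploit this inequality. Adding `±k` with `M k = 0` gives `v ⊥ ker M`, so `v = Bᵀ Y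
c` for some `c`, and `λ = -Y c`. Trading `uB` for another point of the box with `v + uB` fixed shows
that `uB` maximizes `⟪v, ·⟫` over the box, which is the bang-bang law where `v i ≠ 0`. Disjointness
forces `v ≠ 0`, so `c ≠ 0`; if `v i` vanished on an interval, `(Y c) ⬝ᵥ x` would be constant along
every trajectory driven by `u_i` alone, and steering to `0` would give `c = 0`. With analytic data,
zeros of positive measure accumulate and produce such an interval. -/

open scoped Topology

namespace BestApprox

/-! ### Linear differential equations in a Banach algebra: global and analytic solutions. -/

section LinearODE

variable {R : Type*} [NormedRing R] [NormedAlgebra ℝ R]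

/-- The terms of the Neumann series for the initial value problem `X' = a X`, `X 0 = 1`. -/
noncomputable def neumannTerm (a : ℝ → R) : ℕ → ℝ → R
  | 0 => fun _ => 1
  | k + 1 => fun t => ∫ s in (0 : ℝ)..t, a s * neumannTerm a k s

theorem continuous_neumannTerm {a : ℝ → R} (ha : Continuous a) (k : ℕ) :
    Continuous (neumannTerm a k) := by
  induction k with
  | zero => exact continuous_const
  | succ k ih =>
    exact intervalIntegral.continuous_primitive
      (fun _ _ => (ha.mul ih).intervalIntegrable _ _) 0

theorem hasDerivAt_neumannTerm_succ [CompleteSpace R] {a : ℝ → R} (ha : Continuous a)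
    (k : ℕ) (t : ℝ) :
    HasDerivAt (neumannTerm a (k + 1)) (a t * neumannTerm a k t) t :=
  (ha.mul (continuous_neumannTerm ha k)).integral_hasStrictDerivAt 0 t |>.hasDerivAt

/-- Each integration of `|s| ^ k` contributes a factor `1 / (k + 1)`; the resulting factorial makes
the series converge for every `t`. -/
theorem norm_neumannTerm_le [CompleteSpace R] {a : ℝ → R} (ha : Continuous a) {K : ℝ}
    (hK : ∀ t, ‖a t‖ ≤ K) (k : ℕ) (t : ℝ) :
    ‖neumannTerm a k t‖ ≤ ‖(1 : R)‖ * ((K * |t|) ^ k / k.factorial) := by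
  have hK0 : 0 ≤ K := (norm_nonneg _).trans (hK 0)
  induction k generalizing t with
  | zero => simp [neumannTerm]
  | succ k ih =>
    have hc := ha.mul (continuous_neumannTerm ha k)
    calc ‖neumannTerm a (k + 1) t‖
        ≤ ∫ s in uIoc 0 t, ‖a s * neumannTerm a k s‖ :=
          intervalIntegral.norm_integral_le_integral_norm_uIoc
      _ ≤ ∫ s in uIoc 0 t, ‖(1 : R)‖ * K ^ (k + 1) / k.factorial * |s - 0| ^ k := by
          refine setIntegral_mono ?_ ?_ fun s => ?_
          · exact (hc.norm.intervalIntegrable 0 t).def'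
          · exact (Continuous.intervalIntegrable (by fun_prop) 0 t).def'
          · calc ‖a s * neumannTerm a k s‖ ≤ ‖a s‖ * ‖neumannTerm a k s‖ := norm_mul_le _ _
              _ ≤ K * (‖(1 : R)‖ * ((K * |s|) ^ k / k.factorial)) := by
                  gcongr
                  · exact hK s
                  · exact ih s
              _ = _ := by rw [sub_zero, mul_pow]; ring
      _ = _ := by
          rw [integral_const_mul, integral_pow_abs_sub_uIoc, sub_zero, Nat.factorial_succ]
          push_cast
          field_simp
          ring

/-- Global solvability of the linear equation `X' = a X`, `X 0 = 1` in a Banach algebra. -/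
theorem exists_linear_ode_solution [CompleteSpace R] {a : ℝ → R} (ha : Continuous a) {K : ℝ}
    (hK : ∀ t, ‖a t‖ ≤ K) :
    ∃ X : ℝ → R, X 0 = 1 ∧ ∀ t, HasDerivAt X (a t * X t) t := by
  have hK0 : 0 ≤ K := (norm_nonneg _).trans (hK 0)
  have hsum : ∀ t, Summable fun k => neumannTerm a k t := fun t =>
    Summable.of_norm_bounded ((Real.summable_pow_div_factorial (K * |t|)).mul_left _)
      fun k => norm_neumannTerm_le ha hK k t
  refine ⟨fun t => 1 + ∑' k, neumannTerm a (k + 1) t, ?_, fun t => ?_⟩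
  · have : ∀ k, neumannTerm a (k + 1) 0 = 0 := fun k => by simp [neumannTerm]
    simp [this]
  · have hX : 1 + ∑' k, neumannTerm a (k + 1) t = ∑' k, neumannTerm a k t := by
      rw [(hsum t).tsum_eq_zero_add]; rfl
    beta_reduce
    rw [hX, ← (hsum t).tsum_mul_left]
    refine HasDerivAt.const_add _ ?_
    refine hasDerivAt_tsum_of_isPreconnected (t := Ioo (-(|t| + 1)) (|t| + 1)) (y₀ := 0)
      (g := fun k => neumannTerm a (k + 1)) (g' := fun k s => a s * neumannTerm a k s)
      (u := fun k => K * (‖(1 : R)‖ * ((K * (|t| + 1)) ^ k / k.factorial)))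
      (((Real.summable_pow_div_factorial _).mul_left _).mul_left _) isOpen_Ioo isPreconnected_Ioo
      (fun k s _ => hasDerivAt_neumannTerm_succ ha k s) (fun k s hs => ?_) ?_ ?_ ?_
    · have hs' : |s| ≤ |t| + 1 := (abs_lt.2 hs).le
      calc ‖a s * neumannTerm a k s‖ ≤ ‖a s‖ * ‖neumannTerm a k s‖ := norm_mul_le _ _
        _ ≤ K * (‖(1 : R)‖ * ((K * |s|) ^ k / k.factorial)) := by
            gcongr
            · exact hK s
            · exact norm_neumannTerm_le ha hK k s
        _ ≤ _ := by gcongr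
    · have := abs_nonneg t
      constructor <;> linarith
    · exact (summable_nat_add_iff 1).2 (hsum 0)
    · exact abs_lt.1 (lt_add_one _)

/-- The coefficients of the power series solution of `y' = a y`, `y 0 = 1`. -/
noncomputable def odeCoeff (a : ℕ → R) : ℕ → R
  | 0 => 1
  | k + 1 => ((k + 1 : ℝ)⁻¹) • ∑ j : Fin (k + 1), a (k - j) * odeCoeff a j
decreasing_by exact j.2

/-- The recursion averages `k + 1` products of equal bound, so the factor `1 / (k + 1)` cancels; the
extra `μ` in `ha` supplies the missing power. -/
theorem norm_odeCoeff_le {a : ℕ → R} {μ : ℝ} (hμ : 0 ≤ μ)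
    (ha : ∀ k, ‖a k‖ ≤ μ * μ ^ k) (k : ℕ) : ‖odeCoeff a k‖ ≤ ‖(1 : R)‖ * μ ^ k := by
  induction k using Nat.strong_induction_on with
  | _ k ih =>
    cases k with
    | zero => simp [odeCoeff]
    | succ k =>
      have h1 : ∀ j : Fin (k + 1), ‖a (k - j) * odeCoeff a j‖ ≤ ‖(1 : R)‖ * μ ^ (k + 1) := by
        intro j
        calc ‖a (k - j) * odeCoeff a j‖ ≤ ‖a (k - j)‖ * ‖odeCoeff a j‖ := norm_mul_le _ _
          _ ≤ (μ * μ ^ (k - j : ℕ)) * (‖(1 : R)‖ * μ ^ (j : ℕ)) := by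
              gcongr
              · exact ha _
              · exact ih j j.2
          _ = ‖(1 : R)‖ * (μ * μ ^ ((k - j : ℕ) + (j : ℕ))) := by rw [pow_add]; ring
          _ = _ := by rw [Nat.sub_add_cancel (Nat.lt_succ_iff.1 j.2), pow_succ']
      have h2 := (norm_sum_le Finset.univ fun j : Fin (k + 1) => a (k - j) * odeCoeff a j).trans
        (Finset.sum_le_sum fun j _ => h1 j)
      rw [Finset.sum_const, Finset.card_univ, Fintype.card_fin, nsmul_eq_mul] at h2
      rw [odeCoeff, norm_smul, norm_inv, Real.norm_of_nonneg (by positivity),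
        inv_mul_le_iff₀ (by positivity)]
      push_cast at h2
      exact h2

theorem summable_norm_pow_smul {c : ℕ → R} {C μ s : ℝ} (hμ : 0 ≤ μ) (hc : ∀ k, ‖c k‖ ≤ C * μ ^ k)
    (hs : μ * |s| < 1) : Summable fun k => ‖s ^ k • c k‖ := by
  refine Summable.of_nonneg_of_le (fun _ => norm_nonneg _) (fun k => ?_)
    ((summable_geometric_of_lt_one (by positivity) hs).mul_left C)
  rw [norm_smul, norm_pow, Real.norm_eq_abs, mul_pow]
  calc |s| ^ k * ‖c k‖ ≤ |s| ^ k * (C * μ ^ k) := by gcongr; exact hc k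
    _ = _ := by ring

theorem hasDerivAt_tsum_pow_smul [CompleteSpace R] {c : ℕ → R} {C μ s : ℝ} (hμ : 0 < μ)
    (hc : ∀ k, ‖c k‖ ≤ C * μ ^ k) (hs : μ * |s| < 1) :
    HasDerivAt (fun s : ℝ => ∑' k, s ^ k • c k) (∑' k : ℕ, ((k : ℝ) * s ^ (k - 1)) • c k) s := by
  -- Room beyond `|s|` inside the radius `1 / μ`: on `(-ρ, ρ)` the differentiated series is
  -- dominated by a multiple of `k (μ ρ) ^ k`.
  obtain ⟨ρ, hsρ, hρ⟩ : ∃ ρ, |s| < ρ ∧ ρ < μ⁻¹ :=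
    exists_between (by rwa [← one_div, lt_div_iff₀' hμ])
  have hρ0 : 0 < ρ := (abs_nonneg s).trans_lt hsρ
  have hμρ : μ * ρ < 1 := by rwa [← lt_inv_mul_iff₀ hμ, mul_one]
  have hC : 0 ≤ C := by simpa using (norm_nonneg _).trans (hc 0)
  have hu : Summable fun k : ℕ => ρ⁻¹ * C * ((k : ℝ) ^ 1 * (μ * ρ) ^ k) := by
    have h : ‖μ * ρ‖ < 1 := by
      rw [Real.norm_of_nonneg (mul_pos hμ hρ0).le]
      exact hμρ
    exact (summable_pow_mul_geometric_of_norm_lt_one 1 h).mul_left _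
  have hg : ∀ (k : ℕ) (y : ℝ), y ∈ Ioo (-ρ) ρ →
      HasDerivAt (fun s : ℝ => s ^ k • c k) (((k : ℝ) * y ^ (k - 1)) • c k) y :=
    fun k y _ => (hasDerivAt_pow k y).smul_const _
  have hg' : ∀ (k : ℕ) (y : ℝ), y ∈ Ioo (-ρ) ρ →
      ‖((k : ℝ) * y ^ (k - 1)) • c k‖ ≤ ρ⁻¹ * C * ((k : ℝ) ^ 1 * (μ * ρ) ^ k) := by
    intro k y hy
    have hy' : |y| ≤ ρ := (abs_lt.2 hy).le
    rw [norm_smul, norm_mul, norm_pow, Real.norm_eq_abs, Real.norm_eq_abs, Nat.abs_cast]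
    rcases k with _ | k
    · simp
    · calc ((k + 1 : ℕ) : ℝ) * |y| ^ (k + 1 - 1) * ‖c (k + 1)‖
          ≤ ((k + 1 : ℕ) : ℝ) * ρ ^ (k + 1 - 1) * (C * μ ^ (k + 1)) := by
            gcongr
            exact hc _
        _ = _ := by
            rw [mul_pow, Nat.add_sub_cancel, pow_succ ρ]
            field_simp
  have h0 : (0 : ℝ) ∈ Ioo (-ρ) ρ := ⟨by linarith, hρ0⟩
  have hg0 : Summable fun k : ℕ => (0 : ℝ) ^ k • c k :=
    (summable_norm_pow_smul hμ.le hc (by simp)).of_norm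
  exact hasDerivAt_tsum_of_isPreconnected hu isOpen_Ioo isPreconnected_Ioo hg hg' h0 hg0
    (abs_lt.1 hsρ)

/-- The recursion is comparison of coefficients in `y' = a y`: the derivative series is the Cauchy
product of the two series. -/
theorem odeCoeff_succ_smul (q : ℕ → R) (s : ℝ) (k : ℕ) :
    (((k + 1 : ℕ) : ℝ) * s ^ (k + 1 - 1)) • odeCoeff q (k + 1) =
      ∑ ij ∈ Finset.HasAntidiagonal.antidiagonal k,
        (s ^ ij.1 • q ij.1) * (s ^ ij.2 • odeCoeff q ij.2) := by
  have : (((k + 1 : ℕ) : ℝ)) • odeCoeff q (k + 1) =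
      ∑ j : Fin (k + 1), q (k - j) * odeCoeff q j := by
    rw [odeCoeff, smul_smul]
    push_cast
    rw [mul_inv_cancel₀ (by positivity), one_smul]
  rw [Nat.add_sub_cancel, mul_comm, mul_smul, this, Finset.smul_sum,
    Finset.Nat.sum_antidiagonal_eq_sum_range_succ_mk,
    ← Finset.sum_range_reflect, Finset.sum_range]
  refine Finset.sum_congr rfl fun j _ => ?_
  have hj : (j : ℕ) ≤ k := Nat.lt_succ_iff.1 j.2
  have e1 : k + 1 - 1 - (j : ℕ) = k - j := by omega
  have e2 : k - (k - (j : ℕ)) = j := by omega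
  simp only [e1, e2]
  rw [smul_mul_smul_comm, ← pow_add, Nat.sub_add_cancel hj]

theorem hasDerivAt_odeSeries [CompleteSpace R] {q : ℕ → R} {μ s : ℝ} {b : R} (hμ : 0 < μ)
    (hq : ∀ k, ‖q k‖ ≤ μ * μ ^ k) (hs : μ * |s| < 1) (hb : HasSum (fun k => s ^ k • q k) b) :
    HasDerivAt (fun s : ℝ => ∑' k, s ^ k • odeCoeff q k) (b * ∑' k, s ^ k • odeCoeff q k) s := by
  have hc := norm_odeCoeff_le hμ.le hq
  have h1 := summable_norm_pow_smul hμ.le hq hs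
  have h2 := summable_norm_pow_smul hμ.le hc hs
  have h3 : Summable fun k => ((((k + 1 : ℕ) : ℝ) * s ^ (k + 1 - 1)) • odeCoeff q (k + 1)) := by
    simp_rw [odeCoeff_succ_smul]
    exact (summable_norm_sum_mul_antidiagonal_of_summable_norm h1 h2).of_norm
  have h4 : b * ∑' k, s ^ k • odeCoeff q k = ∑' k : ℕ, ((k : ℝ) * s ^ (k - 1)) • odeCoeff q k := by
    rw [← hb.tsum_eq, tsum_mul_tsum_eq_tsum_sum_antidiagonal_of_summable_norm h1 h2,
      Summable.tsum_eq_zero_add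
        ((summable_nat_add_iff (f := fun k : ℕ => ((k : ℝ) * s ^ (k - 1)) • odeCoeff q k) 1).1 h3)]
    simp only [odeCoeff_succ_smul]
    simp
  rw [h4]
  exact hasDerivAt_tsum_pow_smul hμ hc hs

/-- A linear equation `y' = a y`, `y t₀ = 1` with analytic coefficient has an analytic local
solution. -/
theorem exists_analyticAt_linear_ode_solution [CompleteSpace R] {a : ℝ → R} {t₀ : ℝ}
    (ha : AnalyticAt ℝ a t₀) :
    ∃ y : ℝ → R, AnalyticAt ℝ y t₀ ∧ y t₀ = 1 ∧ ∀ᶠ t in 𝓝 t₀, HasDerivAt y (a t * y t) t := by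
  obtain ⟨p, hp⟩ := ha
  obtain ⟨C, r, hC, hr, hpC⟩ := p.le_mul_pow_of_radius_pos hp.radius_pos
  -- One constant absorbs both the prefactor and the ratio of the geometric bound.
  obtain ⟨μ, hrμ, hCμ⟩ : ∃ μ : ℝ, r ≤ μ ∧ C ≤ μ := ⟨max r C, le_max_left _ _, le_max_right _ _⟩
  have hμ0 : 0 < μ := hC.trans_le hCμ
  have hq : ∀ k, ‖p.coeff k‖ ≤ μ * μ ^ k := fun k => by
    rw [p.norm_apply_eq_norm_coef.symm]
    exact (hpC k).trans (by gcongr)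
  have hball : ∀ᶠ s in 𝓝 (0 : ℝ), μ * |s| < 1 := by
    have : Tendsto (fun s : ℝ => μ * |s|) (𝓝 0) (𝓝 (μ * |0|)) :=
      Continuous.tendsto (by fun_prop) 0
    exact this.eventually (gt_mem_nhds (by simp))
  refine ⟨fun t => ∑' k, (t - t₀) ^ k • odeCoeff p.coeff k,
    ⟨fun k => ContinuousMultilinearMap.mkPiRing ℝ (Fin k) (odeCoeff p.coeff k),
    hasFPowerSeriesAt_iff.2 ?_⟩, ?_, ?_⟩
  · filter_upwards [hball] with s hs
    simpa [FormalMultilinearSeries.coeff] using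
      (summable_norm_pow_smul hμ0.le (norm_odeCoeff_le hμ0.le hq) hs).of_norm.hasSum
  · simp only [sub_self]
    rw [tsum_eq_single 0 (fun k hk => by simp [hk])]
    simp [odeCoeff]
  · have ht : Tendsto (fun t : ℝ => t - t₀) (𝓝 t₀) (𝓝 0) := by
      simpa using (continuous_sub_right t₀).tendsto t₀
    filter_upwards [ht.eventually (hball.and (hasFPowerSeriesAt_iff.1 hp))] with t ht'
    have := hasDerivAt_odeSeries hμ0 hq ht'.1 ht'.2
    rw [add_sub_cancel] at this
    exact HasDerivAt.comp_sub_const t t₀ this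

end LinearODE

/-! ### Derivatives of pairings and the adjoint identity. -/

section Calculus

variable {ι : Type*} [Fintype ι]

theorem hasDerivWithinAt_dotProduct {f g : ℝ → ι → ℝ} {f' g' : ι → ℝ} {s : Set ℝ} {t : ℝ}
    (hf : HasDerivWithinAt f f' s t) (hg : HasDerivWithinAt g g' s t) :
    HasDerivWithinAt (fun t => f t ⬝ᵥ g t) (f' ⬝ᵥ g t + f t ⬝ᵥ g') s t := by
  have := HasDerivWithinAt.fun_sum (u := Finset.univ) fun i _ =>
    (hasDerivWithinAt_pi.1 hf i).mul (hasDerivWithinAt_pi.1 hg i)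
  rw [Finset.sum_add_distrib] at this
  exact this

theorem hasDerivAt_dotProduct {f g : ℝ → ι → ℝ} {f' g' : ι → ℝ} {t : ℝ}
    (hf : HasDerivAt f f' t) (hg : HasDerivAt g g' t) :
    HasDerivAt (fun t => f t ⬝ᵥ g t) (f' ⬝ᵥ g t + f t ⬝ᵥ g') t := by
  simpa [hasDerivWithinAt_univ] using
    hasDerivWithinAt_dotProduct hf.hasDerivWithinAt (s := univ) hg.hasDerivWithinAt

/-- The left side is the derivative of `p ⬝ᵥ x` when `p` solves the adjoint equation and `x' = A x +
f`: the drift cancels and only the forcing survives. -/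
theorem adjoint_dotProduct_add (A : Matrix ι ι ℝ) (p x f : ι → ℝ) :
    -(Aᵀ *ᵥ p) ⬝ᵥ x + p ⬝ᵥ (A *ᵥ x + f) = p ⬝ᵥ f := by
  rw [dotProduct_add, neg_dotProduct, Matrix.mulVec_transpose, Matrix.dotProduct_mulVec]
  ring

theorem eq_of_hasDerivWithinAt_zero {s : Set ℝ} (hs : Convex ℝ s) {f : ℝ → ℝ}
    (hf : ∀ t ∈ s, HasDerivWithinAt f 0 s t) {a b : ℝ} (ha : a ∈ s) (hb : b ∈ s) :
    f a = f b := by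
  have := hs.norm_image_sub_le_of_norm_hasDerivWithin_le (C := 0) hf (by simp) hb ha
  simpa [sub_eq_zero] using this

end Calculus

/-! ### Fundamental matrices of the system and of its adjoint. -/

section FundamentalMatrix

open scoped Matrix.Norms.Operator

variable {n : ℕ}

/-- Multiplication of a fixed vector by a matrix, as a continuous linear map. -/
noncomputable def mulVecCLM (c : Fin n → ℝ) : Matrix (Fin n) (Fin n) ℝ →L[ℝ] (Fin n → ℝ) :=
  LinearMap.toContinuousLinearMap
    { toFun := fun M => M *ᵥ c
      map_add' := fun M N => Matrix.add_mulVec M N c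
      map_smul' := fun r M => Matrix.smul_mulVec r M c }

theorem exists_fundamentalMatrix {A : ℝ → Matrix (Fin n) (Fin n) ℝ}
    (hA : ContinuousOn A (Icc (0 : ℝ) 1)) :
    ∃ X : ℝ → Matrix (Fin n) (Fin n) ℝ, X 0 = 1 ∧
      (∀ c, ContDiff ℝ 1 fun t => X t *ᵥ c) ∧
      ∀ t ∈ Icc (0 : ℝ) 1, ∀ c, HasDerivAt (fun t => X t *ᵥ c) (A t *ᵥ (X t *ᵥ c)) t := by
  -- Extension by the endpoint values keeps continuity and the bound, so the solution is global and
  -- has two-sided derivatives at `0` and `1`.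
  set A' : ℝ → Matrix (Fin n) (Fin n) ℝ := IccExtend zero_le_one ((Icc (0 : ℝ) 1).domRestrict A)
  have hA' : Continuous A' := (continuousOn_iff_continuous_domRestrict.1 hA).Icc_extend'
  have hAA' : ∀ t ∈ Icc (0 : ℝ) 1, A' t = A t := fun t ht =>
    IccExtend_of_mem zero_le_one _ ht
  obtain ⟨K, hK⟩ : ∃ K, ∀ t ∈ Icc (0 : ℝ) 1, ‖A t‖ ≤ K := 
    isCompact_Icc.exists_bound_of_continuousOn hA
  obtain ⟨X, hX0, hX⟩ := exists_linear_ode_solution hA' (K := K) fun t => hK _ (Subtype.prop _)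
  have hXc : ∀ c t, HasDerivAt (fun t => X t *ᵥ c) (A' t *ᵥ (X t *ᵥ c)) t := fun c t => by
    rw [Matrix.mulVec_mulVec]
    exact (mulVecCLM c).hasFDerivAt.comp_hasDerivAt t (hX t)
  refine ⟨X, hX0, fun c => ?_, fun t ht c => hAA' t ht ▸ hXc c t⟩
  rw [contDiff_one_iff_deriv]
  refine ⟨fun t => (hXc c t).differentiableAt, ?_⟩
  rw [funext fun t => (hXc c t).deriv]
  have : Continuous fun t => X t *ᵥ c :=
    continuous_iff_continuousAt.2 fun t => (hXc c t).continuousAt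
  exact hA'.matrix_mulVec this

/-- Fundamental matrices `X` of `ẋ = A x` and `Y` of the adjoint equation. -/
theorem exists_fundamentalMatrices {A : ℝ → Matrix (Fin n) (Fin n) ℝ}
    (hA : ContinuousOn A (Icc (0 : ℝ) 1)) :
    ∃ X Y : ℝ → Matrix (Fin n) (Fin n) ℝ, X 0 = 1 ∧ Y 0 = 1 ∧
      (∀ c, ContDiff ℝ 1 fun t => X t *ᵥ c) ∧ (∀ c, ContDiff ℝ 1 fun t => Y t *ᵥ c) ∧
      (∀ t ∈ Icc (0 : ℝ) 1, ∀ c, HasDerivAt (fun t => X t *ᵥ c) (A t *ᵥ (X t *ᵥ c)) t) ∧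
      (∀ t ∈ Icc (0 : ℝ) 1, ∀ c,
        HasDerivAt (fun t => Y t *ᵥ c) (-((A t)ᵀ *ᵥ (Y t *ᵥ c))) t) ∧
      ∀ t ∈ Icc (0 : ℝ) 1, (Y t)ᵀ * X t = 1 := by
  obtain ⟨X, hX0, hXc, hX⟩ := exists_fundamentalMatrix hA
  obtain ⟨Y, hY0, hYc, hY⟩ := exists_fundamentalMatrix (A := fun t => -(A t)ᵀ)
    ((continuous_id.matrix_transpose.neg).comp_continuousOn hA)
  simp only [Matrix.neg_mulVec] at hY
  refine ⟨X, Y, hX0, hY0, hXc, hYc, hX, hY, fun t ht => ?_⟩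
  have h0 : (0 : ℝ) ∈ Icc (0 : ℝ) 1 := by simp
  have key : ∀ c d : Fin n → ℝ, (Y t *ᵥ c) ⬝ᵥ (X t *ᵥ d) = c ⬝ᵥ d := by
    intro c d
    have := eq_of_hasDerivWithinAt_zero (convex_Icc (0 : ℝ) 1)
      (f := fun t => (Y t *ᵥ c) ⬝ᵥ (X t *ᵥ d)) (fun t ht => by
        have := hasDerivAt_dotProduct (hY t ht c) (hX t ht d)
        rw [← add_zero (A t *ᵥ _), adjoint_dotProduct_add, dotProduct_zero] at this
        exact this.hasDerivWithinAt) ht h0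
    simpa [hX0, hY0] using this
  ext i j
  have := key (Pi.single i 1) (Pi.single j 1)
  rw [Matrix.mulVec_single_one, Matrix.mulVec_single_one] at this
  rw [Matrix.mul_apply', Matrix.one_apply]
  refine this.trans ?_
  simp [Pi.single_apply, eq_comm]

theorem exists_analyticAt_fundamentalMatrix {A : ℝ → Matrix (Fin n) (Fin n) ℝ} {t₀ : ℝ}
    (hA : ∀ j k, AnalyticAt ℝ (fun t => A t j k) t₀) (c : Fin n → ℝ) :
    ∃ y : ℝ → Fin n → ℝ, AnalyticAt ℝ y t₀ ∧ y t₀ = c ∧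
      ∀ᶠ t in 𝓝 t₀, HasDerivAt y (A t *ᵥ y t) t := by
  have hA' : AnalyticAt ℝ A t₀ := by
    have : A = fun t => ∑ j, ∑ k, A t j k • Matrix.single j k (1 : ℝ) := by
      funext t
      conv_lhs => rw [Matrix.matrix_eq_sum_single (A t)]
      simp [Matrix.smul_single]
    rw [this]
    refine Finset.analyticAt_fun_sum _ fun j _ => Finset.analyticAt_fun_sum _ fun k _ => ?_
    exact (hA j k).smul analyticAt_const
  obtain ⟨y, hy, hy0, hyd⟩ := exists_analyticAt_linear_ode_solution hA'
  refine ⟨fun t => y t *ᵥ c, ((mulVecCLM c).analyticAt _).comp hy, by simp [hy0], ?_⟩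
  filter_upwards [hyd] with t ht
  rw [Matrix.mulVec_mulVec]
  exact (mulVecCLM c).hasFDerivAt.comp_hasDerivAt t ht

end FundamentalMatrix

/-! ### Absolutely continuous functions on an interval. -/

section AbsolutelyContinuous

variable {ι κ : Type*} [Fintype ι] {a b : ℝ}

theorem absolutelyContinuousOnInterval_apply {x : ℝ → ι → ℝ}
    (hx : AbsolutelyContinuousOnInterval x a b) (i : ι) :
    AbsolutelyContinuousOnInterval (fun t => x t i) a b :=
  squeeze_zero (fun _ => Finset.sum_nonneg fun _ _ => dist_nonneg)
    (fun _ => Finset.sum_le_sum fun _ _ => dist_le_pi_dist _ _ i) hx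

theorem absolutelyContinuousOnInterval_const {E : Type*} [PseudoMetricSpace E] (c : E) :
    AbsolutelyContinuousOnInterval (fun _ => c) a b :=
  ((LipschitzWith.const c).lipschitzOnWith (s := uIcc a b)).absolutelyContinuousOnInterval

theorem absolutelyContinuousOnInterval_sum {E : Type*} [SeminormedAddCommGroup E]
    {f : κ → ℝ → E} (s : Finset κ)
    (hf : ∀ i ∈ s, AbsolutelyContinuousOnInterval (f i) a b) :
    AbsolutelyContinuousOnInterval (fun t => ∑ i ∈ s, f i t) a b := by
  classical
  induction s using Finset.induction_on with
  | empty => simpa using absolutelyContinuousOnInterval_const (0 : E)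
  | insert i s hi ih =>
    simp only [Finset.sum_insert hi]
    exact (hf i (Finset.mem_insert_self i s)).add
      (ih fun j hj => hf j (Finset.mem_insert_of_mem hj))

theorem absolutelyContinuousOnInterval_dotProduct {x y : ℝ → ι → ℝ}
    (hx : AbsolutelyContinuousOnInterval x a b) (hy : AbsolutelyContinuousOnInterval y a b) :
    AbsolutelyContinuousOnInterval (fun t => x t ⬝ᵥ y t) a b :=
  absolutelyContinuousOnInterval_sum _ fun i _ =>
    (absolutelyContinuousOnInterval_apply hx i).mul (absolutelyContinuousOnInterval_apply hy i)

/-- The fundamental theorem of calculus with the derivative prescribed almost everywhere. -/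
theorem integral_eq_sub_of_ae_hasDerivAt {f f' : ℝ → ℝ}
    (hf : AbsolutelyContinuousOnInterval f 0 1)
    (hf' : ∀ᵐ t ∂(volume : Measure ℝ).restrict (Icc (0 : ℝ) 1), HasDerivAt f (f' t) t) :
    ∫ t in Icc (0 : ℝ) 1, f' t = f 1 - f 0 := by
  rw [← hf.integral_deriv_eq_sub, intervalIntegral.integral_of_le zero_le_one,
    ← integral_Icc_eq_integral_Ioc]
  refine integral_congr_ae ?_
  filter_upwards [hf'] with t ht using ht.deriv.symm

end AbsolutelyContinuous

/-! ### Trajectories with `L²` controls and the finite-rank description of `𝓐`. -/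

section AffineSet

variable {n m r : ℕ}

theorem memLp_of_continuousOn {E : Type*} [NormedAddCommGroup E]
    [SecondCountableTopology E] {f : ℝ → E} (hf : ContinuousOn f (Icc (0 : ℝ) 1)) (p : ℝ≥0∞) :
    MemLp f p ((volume : Measure ℝ).restrict (Icc (0 : ℝ) 1)) := by
  obtain ⟨K, hK⟩ := isCompact_Icc.exists_bound_of_continuousOn hf
  refine MemLp.of_bound (hf.aestronglyMeasurable measurableSet_Icc) K ?_
  filter_upwards [ae_restrict_mem measurableSet_Icc] with t ht using hK t ht

theorem continuousOn_mulVec {s : Set ℝ} {A : ℝ → Matrix (Fin n) (Fin m) ℝ} {x : ℝ → Fin m → ℝ}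
    (hA : ContinuousOn A s) (hx : ContinuousOn x s) : ContinuousOn (fun t => A t *ᵥ x t) s :=
  (continuous_fst.matrix_mulVec continuous_snd).comp_continuousOn (hA.prodMk hx)

theorem exists_control_ae_eq {f : ℝ → Fin m → ℝ} (hf : ContinuousOn f (Icc (0 : ℝ) 1)) :
    ∃ g : Control m, ∀ᵐ t ∂(volume : Measure ℝ).restrict (Icc (0 : ℝ) 1),
      WithLp.ofLp (g t) = f t := by
  have hf' : MemLp (fun t => WithLp.toLp 2 (f t)) 2
      ((volume : Measure ℝ).restrict (Icc (0 : ℝ) 1)) :=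
    memLp_of_continuousOn ((PiLp.continuous_toLp 2 _).comp_continuousOn hf) 2
  refine ⟨hf'.toLp, ?_⟩
  filter_upwards [hf'.coeFn_toLp] with t ht
  rw [ht]

theorem inner_control_eq (u v : Control m) :
    inner ℝ u v = ∫ t in Icc (0 : ℝ) 1, WithLp.ofLp (u t) ⬝ᵥ WithLp.ofLp (v t) := by
  rw [L2.inner_def]
  refine integral_congr_ae (Eventually.of_forall fun t => ?_)
  simp [EuclideanSpace.inner_eq_star_dotProduct, dotProduct_comm]

theorem integrable_dotProduct_control (u v : Control m) :
    Integrable (fun t => WithLp.ofLp (u t) ⬝ᵥ WithLp.ofLp (v t))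
      ((volume : Measure ℝ).restrict (Icc (0 : ℝ) 1)) := by
  refine (L2.integrable_inner (𝕜 := ℝ) u v).congr (Eventually.of_forall fun t => ?_)
  simp [EuclideanSpace.inner_eq_star_dotProduct, dotProduct_comm]

theorem memLp_mulVec_control {B : ℝ → Matrix (Fin n) (Fin m) ℝ}
    (hB : ContinuousOn B (Icc (0 : ℝ) 1)) (u : Control m) :
    MemLp (fun t => B t *ᵥ WithLp.ofLp (u t)) 2
      ((volume : Measure ℝ).restrict (Icc (0 : ℝ) 1)) := by
  refine MemLp.of_eval fun i => ?_
  change MemLp (fun t => ∑ k, B t i k * (u t) k) 2 _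
  refine memLp_finsetSum _ fun k _ => ?_
  have hBik : ContinuousOn (fun t => B t i k) (Icc (0 : ℝ) 1) := fun t ht =>
    ((hB t ht).tendsto.apply_nhds i).apply_nhds k
  exact (MemLp.eval_piLp (Lp.memLp u) k).mul (memLp_of_continuousOn hBik ∞)

theorem sum_smul_mulVec_single (M : Matrix (Fin n) (Fin n) ℝ) (c : Fin n → ℝ) :
    ∑ j, c j • (M *ᵥ Pi.single j 1) = M *ᵥ c := by
  ext i
  simp [Matrix.mulVec, dotProduct, mul_comm]

theorem mulVec_single_dotProduct (M : Matrix (Fin n) (Fin n) ℝ) (x : Fin n → ℝ) (j : Fin n) :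
    (M *ᵥ Pi.single j 1) ⬝ᵥ x = (Mᵀ *ᵥ x) j := by
  rw [Matrix.mulVec_single_one]
  rfl

/-- `g j` is the `j`-th column of `Bᵀ Y`. -/
def IsAdjointOutput (B : ℝ → Matrix (Fin n) (Fin m) ℝ) (Y : ℝ → Matrix (Fin n) (Fin n) ℝ)
    (g : Fin n → Control m) : Prop :=
  ∀ j, ∀ᵐ t ∂(volume : Measure ℝ).restrict (Icc (0 : ℝ) 1),
    WithLp.ofLp (g j t) = (B t)ᵀ *ᵥ (Y t *ᵥ Pi.single j 1)

theorem exists_isAdjointOutput {B : ℝ → Matrix (Fin n) (Fin m) ℝ}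
    (hB : ContinuousOn B (Icc (0 : ℝ) 1)) {Y : ℝ → Matrix (Fin n) (Fin n) ℝ}
    (hY : ∀ c, ContDiff ℝ 1 fun t => Y t *ᵥ c) : ∃ g, IsAdjointOutput B Y g := by
  choose g hg using fun j => exists_control_ae_eq
    (f := fun t => (B t)ᵀ *ᵥ (Y t *ᵥ Pi.single j 1)) (by
      refine continuousOn_mulVec ?_ (hY _).continuous.continuousOn
      exact continuous_id.matrix_transpose.comp_continuousOn hB)
  exact ⟨g, hg⟩

variable {A : ℝ → Matrix (Fin n) (Fin n) ℝ} {B : ℝ → Matrix (Fin n) (Fin m) ℝ}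
  {X Y : ℝ → Matrix (Fin n) (Fin n) ℝ} {g : Fin n → Control m}

theorem IsAdjointOutput.dotProduct_ae_eq (hg : IsAdjointOutput B Y g) (j : Fin n)
    (u : Control m) :
    (fun t => WithLp.ofLp (g j t) ⬝ᵥ WithLp.ofLp (u t))
      =ᵐ[(volume : Measure ℝ).restrict (Icc (0 : ℝ) 1)]
      fun t => (Y t *ᵥ Pi.single j 1) ⬝ᵥ (B t *ᵥ WithLp.ofLp (u t)) := by
  filter_upwards [hg j] with t ht
  rw [ht, Matrix.mulVec_transpose, Matrix.dotProduct_mulVec]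

theorem IsAdjointOutput.inner_eq (hg : IsAdjointOutput B Y g) (j : Fin n) (u : Control m) :
    inner ℝ (g j) u =
      ∫ t in Icc (0 : ℝ) 1, (Y t *ᵥ Pi.single j 1) ⬝ᵥ (B t *ᵥ WithLp.ofLp (u t)) := by
  rw [inner_control_eq]
  exact integral_congr_ae (hg.dotProduct_ae_eq j u)

theorem IsAdjointOutput.inner_eq_of_trajectory (hg : IsAdjointOutput B Y g)
    (hYc : ∀ c, ContDiff ℝ 1 fun t => Y t *ᵥ c)
    (hY : ∀ t ∈ Icc (0 : ℝ) 1, ∀ c,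
      HasDerivAt (fun t => Y t *ᵥ c) (-((A t)ᵀ *ᵥ (Y t *ᵥ c))) t)
    (u : Control m) {x : ℝ → Fin n → ℝ} (hx : AbsolutelyContinuousOnInterval x 0 1)
    (hxd : ∀ᵐ t ∂(volume : Measure ℝ).restrict (Icc (0 : ℝ) 1),
      HasDerivAt x (A t *ᵥ x t + B t *ᵥ WithLp.ofLp (u t)) t) (j : Fin n) :
    inner ℝ (g j) u =
      (Y 1 *ᵥ Pi.single j 1) ⬝ᵥ x 1 - (Y 0 *ᵥ Pi.single j 1) ⬝ᵥ x 0 := by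
  rw [hg.inner_eq]
  refine integral_eq_sub_of_ae_hasDerivAt
    (f := fun t => (Y t *ᵥ Pi.single j 1) ⬝ᵥ x t)
    (absolutelyContinuousOnInterval_dotProduct
      (hYc _).contDiffOn.absolutelyContinuousOnInterval hx) ?_
  filter_upwards [hxd, ae_restrict_mem measurableSet_Icc] with t ht htI
  have := hasDerivAt_dotProduct (hY t htI (Pi.single j 1)) ht
  rwa [adjoint_dotProduct_add] at this

/-- Variation of constants: `x = X ξ` with `ξ' = Yᵀ B u`, and `X Yᵀ = 1` turns `X ξ'` into `B u`. -/
theorem IsAdjointOutput.exists_trajectory (hg : IsAdjointOutput B Y g)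
    (hA : ContinuousOn A (Icc (0 : ℝ) 1)) (hB : ContinuousOn B (Icc (0 : ℝ) 1))
    (hXc : ∀ c, ContDiff ℝ 1 fun t => X t *ᵥ c)
    (hX : ∀ t ∈ Icc (0 : ℝ) 1, ∀ c, HasDerivAt (fun t => X t *ᵥ c) (A t *ᵥ (X t *ᵥ c)) t)
    (hYX : ∀ t ∈ Icc (0 : ℝ) 1, (Y t)ᵀ * X t = 1) (hX0 : X 0 = 1)
    (u : Control m) (x₀ : Fin n → ℝ) :
    ∃ x : ℝ → Fin n → ℝ, IsW12 x ∧
      (∀ᵐ t ∂(volume : Measure ℝ).restrict (Icc (0 : ℝ) 1),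
        HasDerivAt x (A t *ᵥ x t + B t *ᵥ WithLp.ofLp (u t)) t) ∧
      x 0 = x₀ ∧ x 1 = X 1 *ᵥ (x₀ + fun j => inner ℝ (g j) u) := by
  set F : Fin n → ℝ → ℝ := fun j t => (Y t *ᵥ Pi.single j 1) ⬝ᵥ (B t *ᵥ WithLp.ofLp (u t))
  have hF : ∀ j, IntervalIntegrable (F j) volume 0 1 := fun j => by
    rw [intervalIntegrable_iff_integrableOn_Icc_of_le zero_le_one]
    exact (integrable_dotProduct_control (g j) u).congr (hg.dotProduct_ae_eq j u)
  set ξ : Fin n → ℝ → ℝ := fun j t => x₀ j + ∫ s in (0 : ℝ)..t, F j s with hξ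
  have hξac : ∀ j, AbsolutelyContinuousOnInterval (ξ j) 0 1 := fun j =>
    (absolutelyContinuousOnInterval_const (x₀ j)).add
      ((hF j).absolutelyContinuousOnInterval_intervalIntegral (by simp))
  have hac : AbsolutelyContinuousOnInterval (fun t => X t *ᵥ fun j => ξ j t) 0 1 := by
    rw [show (fun t => X t *ᵥ fun j => ξ j t) = fun t => ∑ j, ξ j t • (X t *ᵥ Pi.single j 1) from
      funext fun t => (sum_smul_mulVec_single _ _).symm]
    exact absolutelyContinuousOnInterval_sum _ fun j _ =>
      (hξac j).smul (hXc _).contDiffOn.absolutelyContinuousOnInterval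
  have hd : ∀ᵐ t ∂(volume : Measure ℝ).restrict (Icc (0 : ℝ) 1),
      HasDerivAt (fun t => X t *ᵥ fun j => ξ j t)
        (A t *ᵥ (X t *ᵥ fun j => ξ j t) + B t *ᵥ WithLp.ofLp (u t)) t := by
    have hξd := ae_restrict_of_ae (s := Icc (0 : ℝ) 1)
      (ae_all_iff.2 fun j => (hF j).ae_hasDerivAt_integral)
    filter_upwards [hξd, ae_restrict_mem measurableSet_Icc] with t ht htI
    have htu : t ∈ uIcc (0 : ℝ) 1 := by rwa [uIcc_of_le zero_le_one]
    have h := HasDerivAt.fun_sum (u := Finset.univ) fun j _ =>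
      ((ht j htu 0 (by simp)).const_add (x₀ j)).smul (hX t htI (Pi.single j 1))
    have hF' : (fun j => F j t) = (Y t)ᵀ *ᵥ (B t *ᵥ WithLp.ofLp (u t)) := by
      ext j
      exact mulVec_single_dotProduct _ _ _
    have hval : ∑ j, (ξ j t • (A t *ᵥ (X t *ᵥ Pi.single j 1)) + F j t • (X t *ᵥ Pi.single j 1)) =
        A t *ᵥ (X t *ᵥ fun j => ξ j t) + B t *ᵥ WithLp.ofLp (u t) := by
      rw [Finset.sum_add_distrib, sum_smul_mulVec_single (X t) (fun j => F j t), hF',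
        Matrix.mulVec_mulVec _ (X t), mul_eq_one_comm.1 (hYX t htI), Matrix.one_mulVec]
      congr 1
      rw [← sum_smul_mulVec_single (X t), Matrix.mulVec_sum]
      simp_rw [Matrix.mulVec_smul]
    rw [show (fun t => X t *ᵥ fun j => ξ j t) = fun t => ∑ j, ξ j t • (X t *ᵥ Pi.single j 1) from
      funext fun t => (sum_smul_mulVec_single _ _).symm, ← hval]
    exact h
  refine ⟨_, ⟨hac, ?_⟩, hd, ?_, ?_⟩
  · have hcont : ContinuousOn (fun t => A t *ᵥ (X t *ᵥ fun j => ξ j t)) (Icc (0 : ℝ) 1) := by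
      have := hac.continuousOn
      rw [uIcc_of_le zero_le_one] at this
      exact continuousOn_mulVec hA this
    -- The equation itself gives square integrability: `A x` is continuous and `B u` is in `L²`.
    refine ((memLp_of_continuousOn hcont 2).add (memLp_mulVec_control hB u)).ae_eq ?_
    filter_upwards [hd] with t ht using ht.deriv.symm
  · simp [hX0, ξ]
  · congr 1
    ext j
    simp only [ξ, Pi.add_apply, hg.inner_eq]
    rw [intervalIntegral.integral_of_le zero_le_one, integral_Icc_eq_integral_Ioc]

theorem IsAdjointOutput.mem_affineSet_iff (hg : IsAdjointOutput B Y g)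
    (hA : ContinuousOn A (Icc (0 : ℝ) 1)) (hB : ContinuousOn B (Icc (0 : ℝ) 1))
    (hXc : ∀ c, ContDiff ℝ 1 fun t => X t *ᵥ c) (hYc : ∀ c, ContDiff ℝ 1 fun t => Y t *ᵥ c)
    (hX : ∀ t ∈ Icc (0 : ℝ) 1, ∀ c, HasDerivAt (fun t => X t *ᵥ c) (A t *ᵥ (X t *ᵥ c)) t)
    (hY : ∀ t ∈ Icc (0 : ℝ) 1, ∀ c,
      HasDerivAt (fun t => Y t *ᵥ c) (-((A t)ᵀ *ᵥ (Y t *ᵥ c))) t)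
    (hYX : ∀ t ∈ Icc (0 : ℝ) 1, (Y t)ᵀ * X t = 1) (hX0 : X 0 = 1) (hY0 : Y 0 = 1)
    (φ : ((Fin n → ℝ) × (Fin n → ℝ)) →ᵃ[ℝ] (Fin r → ℝ)) (u : Control m) :
    u ∈ affineSet A B φ ↔ ∃ z, φ z = 0 ∧ (Y 1)ᵀ *ᵥ z.2 - z.1 = fun j => inner ℝ (g j) u := by
  constructor
  · rintro ⟨x, hx, hxd, hφ⟩
    refine ⟨_, hφ, ?_⟩
    ext j
    rw [hg.inner_eq_of_trajectory hYc hY u hx.1 hxd j, hY0, mulVec_single_dotProduct,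
      mulVec_single_dotProduct]
    simp
  · rintro ⟨z, hz, hzu⟩
    obtain ⟨x, hx, hxd, hx0, hx1⟩ := hg.exists_trajectory hA hB hXc hX hYX hX0 u z.1
    refine ⟨x, hx, hxd, ?_⟩
    rw [hx0, hx1, ← hzu, add_sub_cancel, Matrix.mulVec_mulVec,
      mul_eq_one_comm.1 (hYX 1 (by simp)), Matrix.one_mulVec]
    exact hz

end AffineSet

/-! ### Projection, and closedness of images of bounded convex sets. -/

section Hilbert

open scoped Pointwise

variable {H : Type*} [NormedAddCommGroup H] [InnerProductSpace ℝ H]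

theorem exists_mem_forall_inner_nonneg [CompleteSpace H] {D : Set H} (hne : D.Nonempty)
    (hcl : IsClosed D) (hcv : Convex ℝ D) :
    ∃ v ∈ D, ∀ w ∈ D, 0 ≤ inner ℝ v (w - v) := by
  obtain ⟨v, hv, h⟩ := exists_norm_eq_iInf_of_complete_convex hne hcl.isComplete hcv 0
  refine ⟨v, hv, fun w hw => ?_⟩
  have := (norm_eq_iInf_iff_real_inner_le_zero hcv hv).1 h w hw
  rw [zero_sub, inner_neg_left] at this
  linarith

/-- Quantitative form of the projection inequality; it yields optimality, uniqueness and the Cauchy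
estimate below. -/
theorem norm_sub_sq_le_of_inner_nonneg {v w : H} (h : 0 ≤ inner ℝ v (w - v)) :
    ‖w - v‖ ^ 2 ≤ ‖w‖ ^ 2 - ‖v‖ ^ 2 := by
  have h1 : w = (w - v) + v := by abel
  have h2 := norm_add_sq_real (w - v) v
  rw [← h1, real_inner_comm] at h2
  linarith

/-- Plays the role of weak compactness. The points of least norm have increasing bounded norms, so
they form a Cauchy sequence, and the limit lies in every `C k`. -/
theorem nonempty_iInter_of_closed_convex_bounded [CompleteSpace H] {C : ℕ → Set H}
    (hmono : Antitone C) (hne : ∀ k, (C k).Nonempty) (hcl : ∀ k, IsClosed (C k))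
    (hcv : ∀ k, Convex ℝ (C k)) (hbd : Bornology.IsBounded (C 0)) : (⋂ k, C k).Nonempty := by
  choose x hxC hx using fun k => exists_mem_forall_inner_nonneg (hne k) (hcl k) (hcv k)
  have hle : ∀ k l, k ≤ l → ‖x l - x k‖ ^ 2 ≤ ‖x l‖ ^ 2 - ‖x k‖ ^ 2 := fun k l hkl =>
    norm_sub_sq_le_of_inner_nonneg (hx k _ (hmono hkl (hxC l)))
  have hm : Monotone fun k => ‖x k‖ ^ 2 := fun k l hkl => by
    have := hle k l hkl
    have := sq_nonneg ‖x l - x k‖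
    beta_reduce
    linarith
  obtain ⟨R, hR⟩ := hbd.exists_norm_le
  have hbdd : BddAbove (range fun k => ‖x k‖ ^ 2) := by
    refine ⟨R ^ 2, ?_⟩
    rintro _ ⟨k, rfl⟩
    have := hR _ (hmono (Nat.zero_le k) (hxC k))
    beta_reduce
    gcongr
  have hcauchy : CauchySeq fun k => ‖x k‖ ^ 2 := (tendsto_atTop_ciSup hm hbdd).cauchySeq
  have hxc : CauchySeq x := by
    refine Metric.cauchySeq_iff'.2 fun ε hε => ?_
    obtain ⟨N, hN⟩ := Metric.cauchySeq_iff'.1 hcauchy (ε ^ 2) (by positivity)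
    refine ⟨N, fun k hk => ?_⟩
    have h1 := (le_abs_self _).trans_lt (Real.dist_eq _ _ ▸ hN k hk)
    rw [dist_eq_norm]
    exact lt_of_pow_lt_pow_left₀ 2 hε.le ((hle N k hk).trans_lt h1)
  obtain ⟨y, hy⟩ := cauchySeq_tendsto_of_complete hxc
  refine ⟨y, mem_iInter.2 fun k => (hcl k).mem_of_tendsto hy ?_⟩
  filter_upwards [eventually_ge_atTop k] with l hl using hmono hl (hxC l)

theorem mem_span_range_of_forall_inner_eq_zero {ι : Type*} [Finite ι] {g : ι → H} {v : H}
    (hv : ∀ k, (∀ j, inner ℝ (g j) k = 0) → inner ℝ v k = 0) :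
    v ∈ Submodule.span ℝ (range g) := by
  have := FiniteDimensional.span_of_finite ℝ (finite_range g)
  rw [← Submodule.orthogonal_orthogonal (Submodule.span ℝ (range g)), Submodule.mem_orthogonal']
  exact fun k hk => hv k fun j =>
    Submodule.inner_right_of_mem_orthogonal (Submodule.subset_span (mem_range_self j)) hk

variable {E : Type*} [NormedAddCommGroup E] [NormedSpace ℝ E]

/-- For `y` in the closure, the parts of `C` mapped within `1 / (k + 1)` of `y` are nested,
nonempty, closed, convex and bounded; a common point is mapped to `y`. -/
theorem isClosed_image_of_convex_bounded [CompleteSpace H] (M : H →L[ℝ] E) {C : Set H}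
    (hcl : IsClosed C) (hcv : Convex ℝ C) (hbd : Bornology.IsBounded C) :
    IsClosed (M '' C) := by
  refine isClosed_of_closure_subset fun y hy => ?_
  have hlim : Tendsto (fun k : ℕ => 1 / ((k : ℝ) + 1)) atTop (𝓝 0) :=
    tendsto_one_div_add_atTop_nhds_zero_nat
  obtain ⟨c, hc⟩ := nonempty_iInter_of_closed_convex_bounded
    (C := fun k : ℕ => C ∩ M ⁻¹' Metric.closedBall y (1 / ((k : ℝ) + 1)))
    (fun k l hkl => inter_subset_inter_right _ (preimage_mono
      (Metric.closedBall_subset_closedBall (by gcongr))))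
    (fun k => by
      obtain ⟨_, ⟨c, hc, rfl⟩, h⟩ := Metric.mem_closure_iff.1 hy (1 / ((k : ℝ) + 1)) (by positivity)
      exact ⟨c, hc, by rw [mem_preimage, Metric.mem_closedBall, dist_comm]; exact h.le⟩)
    (fun k => hcl.inter (Metric.isClosed_closedBall.preimage M.continuous))
    (fun k => hcv.inter ((convex_closedBall _ _).linear_preimage M.toLinearMap))
    (hbd.subset inter_subset_left)
  rw [mem_iInter] at hc
  refine ⟨c, (hc 0).1, ?_⟩
  exact dist_le_zero.1 (ge_of_tendsto' hlim fun k => (hc k).2)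

/-- The set is the preimage under `M` of `S - M '' C`, a closed set minus a compact one. -/
theorem isClosed_preimage_sub [CompleteSpace H] [ProperSpace E] (M : H →L[ℝ] E) {S : Set E}
    (hS : IsClosed S) {C : Set H} (hcl : IsClosed C) (hcv : Convex ℝ C)
    (hbd : Bornology.IsBounded C) : IsClosed {w : H | ∃ b ∈ C, M (w + b) ∈ S} := by
  have hK : IsCompact (M '' C) := Metric.isCompact_of_isClosed_isBounded
    (isClosed_image_of_convex_bounded M hcl hcv hbd) (M.lipschitz.isBounded_image hbd)
  have : {w : H | ∃ b ∈ C, M (w + b) ∈ S} = M ⁻¹' (S + -(M '' C)) := by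
    ext w
    constructor
    · rintro ⟨b, hb, h⟩
      exact ⟨_, h, _, Set.neg_mem_neg.2 (mem_image_of_mem M hb), by simp⟩
    · rintro ⟨s, hs, z, hz, h⟩
      obtain ⟨b, hb, hbz⟩ := Set.mem_neg.1 hz
      refine ⟨b, hb, ?_⟩
      rw [map_add, ← h, hbz]
      simpa using hs
  rw [this]
  exact (hS.add_right_of_isCompact hK.neg).preimage M.continuous

end Hilbert

/-! ### The box of admissible controls and maximizers of linear functionals on it. -/

section Box

variable {m : ℕ} {lo hi : Fin m → ℝ → ℝ}

/-- An `L²`-convergent sequence has an a.e. convergent subsequence, and pointwise bounds pass to the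
limit. -/
theorem isClosed_box : IsClosed (box lo hi) := by
  refine IsSeqClosed.isClosed fun u v hu huv => ?_
  obtain ⟨ns, -, hns⟩ := (tendstoInMeasure_of_tendsto_Lp huv).exists_seq_tendsto_ae
  have hall := ae_all_iff.2 fun k => hu (ns k)
  filter_upwards [hns, hall] with t ht hk i
  have hti : Tendsto (fun k => u (ns k) t i) atTop (𝓝 (v t i)) :=
    ((PiLp.continuous_ofLp 2 _).tendsto _ |>.comp ht).apply_nhds i
  exact ⟨ge_of_tendsto' hti fun k => (hk k i).1, le_of_tendsto' hti fun k => (hk k i).2⟩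

theorem convex_box : Convex ℝ (box lo hi) := by
  intro u hu v hv a b ha hb hab
  filter_upwards [hu, hv, Lp.coeFn_add (a • u) (b • v), Lp.coeFn_smul a u, Lp.coeFn_smul b v]
    with t hut hvt h1 h2 h3 i
  rw [h1, Pi.add_apply, h2, h3]
  exact (convex_Icc (lo i t) (hi i t)) (hut i) (hvt i) ha hb hab

theorem isBounded_box (hlo : ∀ i, ContinuousOn (lo i) (Icc (0 : ℝ) 1))
    (hhi : ∀ i, ContinuousOn (hi i) (Icc (0 : ℝ) 1)) : Bornology.IsBounded (box lo hi) := by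
  obtain ⟨g, hg⟩ := exists_control_ae_eq (f := fun t i => |lo i t| + |hi i t|)
    (continuousOn_pi.2 fun i => (hlo i).abs.add (hhi i).abs)
  refine isBounded_iff_forall_norm_le.2 ⟨‖g‖, fun u hu => Lp.norm_le_norm_of_ae_le ?_⟩
  filter_upwards [hu, hg] with t hut hgt
  rw [EuclideanSpace.norm_eq, EuclideanSpace.norm_eq]
  refine Real.sqrt_le_sqrt (Finset.sum_le_sum fun i _ => ?_)
  have : g t i = |lo i t| + |hi i t| := congrFun hgt i
  rw [this, Real.norm_eq_abs, Real.norm_eq_abs, abs_of_nonneg (a := |lo i t| + _) (by positivity)]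
  gcongr
  rw [abs_le]
  have h1 := neg_abs_le (lo i t)
  have h2 := le_abs_self (hi i t)
  have h3 := abs_nonneg (lo i t)
  have h4 := abs_nonneg (hi i t)
  constructor <;> linarith [(hut i).1, (hut i).2]

theorem box_nonempty (hlo : ∀ i, ContinuousOn (lo i) (Icc (0 : ℝ) 1))
    (hlohi : ∀ i, ∀ t ∈ Icc (0 : ℝ) 1, lo i t < hi i t) : (box lo hi).Nonempty := by
  obtain ⟨g, hg⟩ := exists_control_ae_eq (f := fun t i => lo i t) (continuousOn_pi.2 hlo)
  refine ⟨g, ?_⟩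
  filter_upwards [hg, ae_restrict_mem measurableSet_Icc] with t ht htI i
  have : g t i = lo i t := congrFun ht i
  rw [this]
  exact ⟨le_rfl, (hlohi i t htI).le⟩

/-- The pointwise maximizer in the box of the `i`-th component of `⟪v, ·⟫`. -/
theorem exists_mem_box_bang (hlo : ∀ i, ContinuousOn (lo i) (Icc (0 : ℝ) 1))
    (hhi : ∀ i, ContinuousOn (hi i) (Icc (0 : ℝ) 1))
    (hlohi : ∀ i, ∀ t ∈ Icc (0 : ℝ) 1, lo i t < hi i t) (v : Control m) {b : Control m}
    (hb : b ∈ box lo hi) (i : Fin m) :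
    ∃ w ∈ box lo hi, ∀ᵐ t ∂(volume : Measure ℝ).restrict (Icc (0 : ℝ) 1),
      w t i = (if 0 < v t i then hi i t else if v t i < 0 then lo i t else b t i) ∧
      ∀ j, j ≠ i → w t j = b t j := by
  classical
  set f : ℝ → Fin m → ℝ := fun t => Function.update (WithLp.ofLp (b t)) i
    (if 0 < v t i then hi i t else if v t i < 0 then lo i t else b t i) with hf
  have hvi : Measurable fun t => v t i :=
    (measurable_pi_apply i).comp ((PiLp.continuous_ofLp 2 _).measurable.comp
      (Lp.stronglyMeasurable v).measurable)
  have hmem : MemLp (fun t => WithLp.toLp 2 (f t)) 2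
      ((volume : Measure ℝ).restrict (Icc (0 : ℝ) 1)) := by
    refine MemLp.of_eval_piLp fun j => ?_
    by_cases hj : j = i
    · subst hj
      have h := MemLp.piecewise (measurableSet_lt (measurable_const (a := (0 : ℝ))) hvi)
        ((memLp_of_continuousOn (hhi j) 2).restrict _)
        ((MemLp.piecewise (measurableSet_lt hvi (measurable_const (a := (0 : ℝ))))
          ((memLp_of_continuousOn (hlo j) 2).restrict _)
          ((MemLp.eval_piLp (Lp.memLp b) j).restrict _)).restrict _)
      refine h.ae_eq (Eventually.of_forall fun t => ?_)
      simp only [f, Set.piecewise, Function.update_self, mem_ofPred_eq]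
    · simpa [f, hj] using MemLp.eval_piLp (Lp.memLp b) j
  set w : Control m := hmem.toLp
  have hw : ∀ᵐ t ∂(volume : Measure ℝ).restrict (Icc (0 : ℝ) 1),
      w t i = (if 0 < v t i then hi i t else if v t i < 0 then lo i t else b t i) ∧
      ∀ j, j ≠ i → w t j = b t j := by
    filter_upwards [hmem.coeFn_toLp] with t ht
    rw [ht]
    refine ⟨by simp [f], fun j hj => by simp [f, hj]⟩
  refine ⟨w, ?_, hw⟩
  filter_upwards [hw, hb, ae_restrict_mem measurableSet_Icc] with t ht hbt htI j
  by_cases hj : j = i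
  · subst hj
    rw [ht.1]
    have := hlohi j t htI
    have := hbt j
    split_ifs <;> constructor <;> linarith
  · rw [ht.2 j hj]
    exact hbt j

/-- A maximizer of `⟪v, ·⟫` over the box is bang-bang where `v` does not vanish. -/
theorem bang_of_forall_inner_nonneg (hlo : ∀ i, ContinuousOn (lo i) (Icc (0 : ℝ) 1))
    (hhi : ∀ i, ContinuousOn (hi i) (Icc (0 : ℝ) 1))
    (hlohi : ∀ i, ∀ t ∈ Icc (0 : ℝ) 1, lo i t < hi i t) {v b : Control m}
    (hb : b ∈ box lo hi) (hmax : ∀ w ∈ box lo hi, 0 ≤ inner ℝ v (b - w)) (i : Fin m) :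
    ∀ᵐ t ∂(volume : Measure ℝ).restrict (Icc (0 : ℝ) 1),
      (0 < v t i → b t i = hi i t) ∧ (v t i < 0 → b t i = lo i t) := by
  obtain ⟨w, hw, hwt⟩ := exists_mem_box_bang hlo hhi hlohi v hb i
  have hval : (fun t => WithLp.ofLp (v t) ⬝ᵥ WithLp.ofLp ((w - b : Control m) t))
      =ᵐ[(volume : Measure ℝ).restrict (Icc (0 : ℝ) 1)] fun t => v t i * (w t i - b t i) := by
    filter_upwards [hwt, Lp.coeFn_sub w b] with t ht h1
    rw [h1, dotProduct, Finset.sum_eq_single i]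
    · rfl
    · intro j _ hj
      simp [ht.2 j hj]
    · simp
  -- The gain from replacing `b` by `w` is pointwise nonnegative, while maximality of `b` makes its
  -- integral nonpositive; hence it vanishes a.e.
  have hnn : 0 ≤ᵐ[(volume : Measure ℝ).restrict (Icc (0 : ℝ) 1)]
      fun t => v t i * (w t i - b t i) := by
    filter_upwards [hwt, hb] with t ht hbt
    rw [ht.1]
    have := hbt i
    rcases lt_trichotomy (v t i) 0 with h | h | h
    · rw [if_neg h.not_gt, if_pos h]
      exact mul_nonneg_of_nonpos_of_nonpos h.le (by linarith)
    · simp [h]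
    · rw [if_pos h]
      exact mul_nonneg h.le (by linarith)
  have hint := (integrable_dotProduct_control v (w - b)).congr hval
  have hle : ∫ t in Icc (0 : ℝ) 1, v t i * (w t i - b t i) ≤ 0 := by
    rw [← integral_congr_ae hval, ← inner_control_eq, ← neg_sub, inner_neg_right]
    linarith [hmax w hw]
  have hzero := (integral_eq_zero_iff_of_nonneg_ae hnn hint).1
    (le_antisymm hle (integral_nonneg_of_ae hnn))
  filter_upwards [hwt, hzero] with t ht hz
  have hz' : v t i * (w t i - b t i) = 0 := hz
  rw [ht.1] at hz'
  constructor
  · intro h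
    rw [if_pos h] at hz'
    linarith [(mul_eq_zero.1 hz').resolve_left h.ne']
  · intro h
    rw [if_neg h.not_gt, if_pos h] at hz'
    linarith [(mul_eq_zero.1 hz').resolve_left h.ne]

end Box

/-! ### The costate, absence of singular intervals, and the analytic case. -/

section Costate

variable {n m r : ℕ} {A : ℝ → Matrix (Fin n) (Fin n) ℝ} {B : ℝ → Matrix (Fin n) (Fin m) ℝ}
  {X Y : ℝ → Matrix (Fin n) (Fin n) ℝ} {g : Fin n → Control m}

theorem IsAdjointOutput.exists_of_forall_inner_eq_zero (hg : IsAdjointOutput B Y g)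
    {v : Control m} (hv : ∀ k, (∀ j, inner ℝ (g j) k = 0) → inner ℝ v k = 0) :
    ∃ c : Fin n → ℝ, ∀ᵐ t ∂(volume : Measure ℝ).restrict (Icc (0 : ℝ) 1),
      WithLp.ofLp (v t) = (B t)ᵀ *ᵥ (Y t *ᵥ c) := by
  have hmem := mem_span_range_of_forall_inner_eq_zero hv
  clear hv
  induction hmem using Submodule.span_induction with
  | mem _ h =>
    obtain ⟨j, rfl⟩ := h
    exact ⟨_, hg j⟩
  | zero =>
    refine ⟨0, ?_⟩
    filter_upwards [Lp.coeFn_zero (EuclideanSpace ℝ (Fin m)) 2 (volume.restrict (Icc (0 : ℝ) 1))]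
      with t ht
    rw [ht]
    simp
  | add u w _ _ hu hw =>
    obtain ⟨c, hc⟩ := hu
    obtain ⟨d, hd⟩ := hw
    refine ⟨c + d, ?_⟩
    filter_upwards [hc, hd, Lp.coeFn_add u w] with t h1 h2 h3
    rw [h3, Pi.add_apply, WithLp.ofLp_add, h1, h2, Matrix.mulVec_add, Matrix.mulVec_add]
  | smul a u _ hu =>
    obtain ⟨c, hc⟩ := hu
    refine ⟨a • c, ?_⟩
    filter_upwards [hc, Lp.coeFn_smul a u] with t h1 h3
    rw [h3, Pi.smul_apply, WithLp.ofLp_smul, h1, Matrix.mulVec_smul, Matrix.mulVec_smul]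

/-- Steering `-z` to `0` makes the boundary term `Y(1)ᵀ x(1) - x(0)` equal to `z`. -/
theorem IsAdjointOutput.exists_inner_eq (hg : IsAdjointOutput B Y g)
    (hA : ContinuousOn A (Icc (0 : ℝ) 1)) (hB : ContinuousOn B (Icc (0 : ℝ) 1))
    (hYc : ∀ c, ContDiff ℝ 1 fun t => Y t *ᵥ c)
    (hY : ∀ t ∈ Icc (0 : ℝ) 1, ∀ c,
      HasDerivAt (fun t => Y t *ᵥ c) (-((A t)ᵀ *ᵥ (Y t *ᵥ c))) t)
    (hY0 : Y 0 = 1) (hctrl : ControllableOn A B 0 1) (z : Fin n → ℝ) :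
    ∃ u : Control m, (fun j => inner ℝ (g j) u) = z := by
  obtain ⟨w, x, hw, hx0, hxd, hx1⟩ := hctrl (-z)
  obtain ⟨u, hu⟩ := exists_control_ae_eq hw
  refine ⟨u, funext fun j => ?_⟩
  have hxc : ContinuousOn x (Icc (0 : ℝ) 1) := fun t ht => (hxd t ht).continuousWithinAt
  obtain ⟨K, hK⟩ := isCompact_Icc.exists_bound_of_continuousOn
    ((continuousOn_mulVec hA hxc).add (continuousOn_mulVec hB hw))
  have hlip : LipschitzOnWith K.toNNReal x (uIcc (0 : ℝ) 1) := by
    rw [uIcc_of_le zero_le_one]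
    refine (convex_Icc (0 : ℝ) 1).lipschitzOnWith_of_nnnorm_hasDerivWithin_le hxd fun t ht => ?_
    rw [← NNReal.coe_le_coe, coe_nnnorm]
    exact (hK t ht).trans (Real.le_coe_toNNReal K)
  have hae : ∀ᵐ t ∂(volume : Measure ℝ).restrict (Icc (0 : ℝ) 1),
      HasDerivAt x (A t *ᵥ x t + B t *ᵥ WithLp.ofLp (u t)) t := by
    -- Controllability gives derivatives within `[0,1]`; these are two-sided off the endpoints, a
    -- null set.
    have hIoo : ∀ᵐ t ∂(volume : Measure ℝ).restrict (Icc (0 : ℝ) 1), t ∈ Ioo (0 : ℝ) 1 := by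
      rw [← restrict_Ioo_eq_restrict_Icc]
      exact ae_restrict_mem measurableSet_Ioo
    filter_upwards [hu, hIoo] with t ht htI
    rw [ht]
    exact (hxd t (Ioo_subset_Icc_self htI)).hasDerivAt (Icc_mem_nhds htI.1 htI.2)
  rw [hg.inner_eq_of_trajectory hYc hY u hlip.absolutelyContinuousOnInterval hae j, hx1, hx0, hY0,
    mulVec_single_dotProduct, mulVec_single_dotProduct]
  simp

/-- If the `i`-th output vanishes, `(Y c) ⬝ᵥ x` is conserved by the single-input system. As every
`x₀` can be steered to `0`, `Y s₀ *ᵥ c` is orthogonal to everything, and `Y s₀` is invertible. -/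
theorem eq_zero_of_controllableWrtOn
    (hY : ∀ t ∈ Icc (0 : ℝ) 1, ∀ c,
      HasDerivAt (fun t => Y t *ᵥ c) (-((A t)ᵀ *ᵥ (Y t *ᵥ c))) t)
    (hYX : ∀ t ∈ Icc (0 : ℝ) 1, (Y t)ᵀ * X t = 1) {i : Fin m} {s₀ s₁ : ℝ} (h0 : 0 ≤ s₀)
    (h01 : s₀ < s₁) (h1 : s₁ ≤ 1) (hctrl : ControllableWrtOn A B i s₀ s₁) {c : Fin n → ℝ}
    (hc : ∀ t ∈ Icc s₀ s₁, ((B t)ᵀ *ᵥ (Y t *ᵥ c)) i = 0) : c = 0 := by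
  have hsub : Icc s₀ s₁ ⊆ Icc (0 : ℝ) 1 := Icc_subset_Icc h0 h1
  have hs₀ : s₀ ∈ Icc s₀ s₁ := left_mem_Icc.2 h01.le
  have hort : ∀ x₀, (Y s₀ *ᵥ c) ⬝ᵥ x₀ = 0 := by
    intro x₀
    obtain ⟨w, x, hw, hx0, hxd, hx1⟩ := hctrl x₀
    have := eq_of_hasDerivWithinAt_zero (convex_Icc s₀ s₁)
      (f := fun t => (Y t *ᵥ c) ⬝ᵥ x t) (fun t ht => by
        have := hasDerivWithinAt_dotProduct (hY t (hsub ht) c).hasDerivWithinAt (hxd t ht)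
        rw [adjoint_dotProduct_add, dotProduct_smul, dotProduct_comm] at this
        have h2 : (B t).col i ⬝ᵥ (Y t *ᵥ c) = 0 := hc t ht
        rwa [h2, smul_zero] at this) hs₀ (right_mem_Icc.2 h01.le)
    simpa [hx0, hx1] using this
  have hYc : Y s₀ *ᵥ c = 0 := dotProduct_eq_zero _ hort
  have hXY : (X s₀)ᵀ * Y s₀ = 1 := by
    rw [← Matrix.transpose_transpose (Y s₀), ← Matrix.transpose_mul, hYX s₀ (hsub hs₀),
      Matrix.transpose_one]
  rw [← Matrix.one_mulVec c, ← hXY, ← Matrix.mulVec_mulVec, hYc, Matrix.mulVec_zero]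

/-- Near every point of `[0,1]` an adjoint solution extends to an analytic function when the
coefficient matrix is analytic. -/
theorem exists_analyticAt_adjoint_extension
    (hA : ∀ j k, AnalyticOn ℝ (fun t => A t j k) (Icc (0 : ℝ) 1))
    (hX : ∀ t ∈ Icc (0 : ℝ) 1, ∀ c, HasDerivAt (fun t => X t *ᵥ c) (A t *ᵥ (X t *ᵥ c)) t)
    (hYX : ∀ t ∈ Icc (0 : ℝ) 1, (Y t)ᵀ * X t = 1) (c : Fin n → ℝ) {τ : ℝ}
    (hτ : τ ∈ Icc (0 : ℝ) 1) :
    ∃ y : ℝ → Fin n → ℝ, AnalyticAt ℝ y τ ∧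
      ∀ᶠ t in 𝓝 τ, t ∈ Icc (0 : ℝ) 1 → y t = Y t *ᵥ c := by
  choose Ã hAÃτ hAÃ hÃ using fun j k => (hA j k τ hτ).exists_analyticAt
  simp only [insert_eq_of_mem hτ] at hAÃ
  have hAÃ' : ∀ t ∈ Icc (0 : ℝ) 1, (Matrix.of fun j k => Ã j k t) = A t := fun t ht => by
    ext j k
    exact (hAÃ j k ht).symm
  obtain ⟨y, hy, hyτ, hyd⟩ := exists_analyticAt_fundamentalMatrix
    (A := fun t => -(Matrix.of fun j k => Ã j k t)ᵀ) (t₀ := τ)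
    (fun j k => (hÃ k j).neg) (Y τ *ᵥ c)
  refine ⟨y, hy, ?_⟩
  obtain ⟨ε, hε, hball⟩ := Metric.eventually_nhds_iff_ball.1 hyd
  filter_upwards [Metric.ball_mem_nhds τ hε] with t ht htI
  have hconv : Convex ℝ (Metric.ball τ ε ∩ Icc 0 1) := (convex_ball τ ε).inter (convex_Icc 0 1)
  have hYX' : ∀ t ∈ Icc (0 : ℝ) 1, X t * (Y t)ᵀ = 1 := fun t ht => mul_eq_one_comm.1 (hYX t ht)
  refine dotProduct_eq _ _ fun w => ?_
  -- Uniqueness by duality: `y` and `Y c` have the same conserved pairings with all `X d`, and `X t`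
  -- is invertible.
  have key : ∀ d, y t ⬝ᵥ (X t *ᵥ d) = (Y τ *ᵥ c) ⬝ᵥ (X τ *ᵥ d) := by
    intro d
    have := eq_of_hasDerivWithinAt_zero hconv (f := fun t => y t ⬝ᵥ (X t *ᵥ d))
      (fun s hs => by
        have h := hball s hs.1
        rw [hAÃ' s hs.2, Matrix.neg_mulVec] at h
        have := hasDerivAt_dotProduct h (hX s hs.2 d)
        rw [← add_zero (A s *ᵥ _), adjoint_dotProduct_add, dotProduct_zero] at this
        exact this.hasDerivWithinAt) ⟨ht, htI⟩ ⟨Metric.mem_ball_self hε, hτ⟩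
    rw [← hyτ]
    exact this
  have hpair : ∀ s ∈ Icc (0 : ℝ) 1, ∀ d, (Y s *ᵥ c) ⬝ᵥ (X s *ᵥ d) = c ⬝ᵥ d := fun s hs d => by
    rw [← Matrix.vecMul_transpose, ← Matrix.dotProduct_mulVec, Matrix.mulVec_mulVec, hYX s hs,
      Matrix.one_mulVec]
  have hw : w = X t *ᵥ ((Y t)ᵀ *ᵥ w) := by
    rw [Matrix.mulVec_mulVec, hYX' t htI, Matrix.one_mulVec]
  rw [hw, key, hpair τ hτ, hpair t htI]

/-- A finite zero set would be null, so zeros accumulate at some `τ` in `[0,1]`. Since `τ` may be an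
endpoint, the identity theorem is applied to an analytic extension `Q` near `τ`. -/
theorem exists_Icc_eq_zero_of_analyticOn
    (hA : ∀ j k, AnalyticOn ℝ (fun t => A t j k) (Icc (0 : ℝ) 1))
    (hB : ∀ j k, AnalyticOn ℝ (fun t => B t j k) (Icc (0 : ℝ) 1))
    (hX : ∀ t ∈ Icc (0 : ℝ) 1, ∀ c, HasDerivAt (fun t => X t *ᵥ c) (A t *ᵥ (X t *ᵥ c)) t)
    (hYX : ∀ t ∈ Icc (0 : ℝ) 1, (Y t)ᵀ * X t = 1) {c : Fin n → ℝ} {i : Fin m}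
    (h : ¬ ∀ᵐ t ∂(volume : Measure ℝ).restrict (Icc (0 : ℝ) 1),
      ((B t)ᵀ *ᵥ (Y t *ᵥ c)) i ≠ 0) :
    ∃ s₀ s₁ : ℝ, 0 ≤ s₀ ∧ s₀ < s₁ ∧ s₁ ≤ 1 ∧
      ∀ t ∈ Icc s₀ s₁, ((B t)ᵀ *ᵥ (Y t *ᵥ c)) i = 0 := by
  set Z : Set ℝ := {t | t ∈ Icc (0 : ℝ) 1 ∧ ((B t)ᵀ *ᵥ (Y t *ᵥ c)) i = 0} with hZ
  have hinf : Z.Infinite := by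
    intro hfin
    refine h ?_
    have hnot : ∀ᵐ t ∂(volume : Measure ℝ), t ∉ Z := 
      measure_eq_zero_iff_ae_notMem.1 (hfin.measure_zero _)
    filter_upwards [ae_restrict_of_ae hnot, ae_restrict_mem measurableSet_Icc] with t ht htI h0
    exact ht ⟨htI, h0⟩
  obtain ⟨τ, hτ, hacc⟩ := hinf.exists_accPt_of_subset_isCompact isCompact_Icc fun t ht => ht.1
  obtain ⟨y, hy, hyY⟩ := exists_analyticAt_adjoint_extension hA hX hYX c hτ
  choose B' hBB'τ hBB' hB' using fun j => (hB j i τ hτ).exists_analyticAt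
  simp only [insert_eq_of_mem hτ] at hBB'
  set Q : ℝ → ℝ := fun t => ∑ j, B' j t * y t j with hQ
  have hQan : AnalyticAt ℝ Q τ :=
    Finset.analyticAt_fun_sum _ fun j _ => (hB' j).mul (analyticAt_pi_iff.1 hy j)
  have hQq : ∀ᶠ t in 𝓝 τ, t ∈ Icc (0 : ℝ) 1 → Q t = ((B t)ᵀ *ᵥ (Y t *ᵥ c)) i := by
    filter_upwards [hyY] with t ht htI
    rw [← ht htI]
    exact Finset.sum_congr rfl fun j _ => by rw [← hBB' j htI]; rfl
  have hfreq : ∃ᶠ t in 𝓝[≠] τ, Q t = 0 := by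
    refine ((accPt_iff_frequently_nhdsNE.1 hacc).and_eventually
      (hQq.filter_mono nhdsWithin_le_nhds)).mono fun t ht => ?_
    rw [ht.2 ht.1.1]
    exact ht.1.2
  have hev := hQan.frequently_zero_iff_eventually_zero.1 hfreq
  obtain ⟨ε, hε, hball⟩ := Metric.eventually_nhds_iff_ball.1 (hev.and hQq)
  -- Halving `ε` fits a closed interval in the open ball; clipping keeps it in `[0,1]`.
  refine ⟨max 0 (τ - ε / 2), min 1 (τ + ε / 2), le_max_left _ _, ?_, min_le_left _ _, ?_⟩
  · rw [max_lt_iff, lt_min_iff, lt_min_iff]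
    have := hτ.1
    have := hτ.2
    refine ⟨⟨?_, ?_⟩, ?_, ?_⟩ <;> linarith
  · intro t ht
    rw [mem_Icc, max_le_iff, le_min_iff] at ht
    have htb : t ∈ Metric.ball τ ε := by
      rw [Real.ball_eq_Ioo]
      constructor <;> linarith [ht.1.2, ht.2.2]
    rw [← (hball t htb).2 ⟨ht.1.1, ht.2.1⟩]
    exact (hball t htb).1

end Costate

/-! ### The affine subspace of admissible boundary values. -/

section BoundaryData

variable {n m r : ℕ}

theorem costPf_eq (v : Control m) : costPf v = 1 / 2 * ‖v‖ ^ 2 := by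
  rw [costPf, ← real_inner_self_eq_norm_sq, L2.inner_def]
  simp

/-- The values of `Yᵀ x₁ - x₀` over the boundary data `(x₀, x₁)` with `φ (x₀, x₁) = 0`. -/
def boundarySubspace (Y : Matrix (Fin n) (Fin n) ℝ)
    (φ : ((Fin n → ℝ) × (Fin n → ℝ)) →ᵃ[ℝ] (Fin r → ℝ)) : AffineSubspace ℝ (Fin n → ℝ) :=
  ((AffineSubspace.mk' (0 : Fin r → ℝ) ⊥).comap φ).map
    ((Yᵀ.mulVecLin ∘ₗ LinearMap.snd ℝ (Fin n → ℝ) (Fin n → ℝ) -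
      LinearMap.fst ℝ (Fin n → ℝ) (Fin n → ℝ)).toAffineMap)

theorem mem_boundarySubspace {Y : Matrix (Fin n) (Fin n) ℝ}
    {φ : ((Fin n → ℝ) × (Fin n → ℝ)) →ᵃ[ℝ] (Fin r → ℝ)} {y : Fin n → ℝ} :
    y ∈ boundarySubspace Y φ ↔ ∃ z, φ z = 0 ∧ Yᵀ *ᵥ z.2 - z.1 = y := by
  simp [boundarySubspace, ← Matrix.mulVec_transpose, AffineSubspace.mem_map,
    AffineSubspace.mem_comap, AffineSubspace.mem_mk']

end BoundaryData

/-! ### Existence, uniqueness and first-order conditions for (Pf). -/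

section Problem

variable {n m r : ℕ} {A : ℝ → Matrix (Fin n) (Fin n) ℝ} {B : ℝ → Matrix (Fin n) (Fin m) ℝ}
  {φ : ((Fin n → ℝ) × (Fin n → ℝ)) →ᵃ[ℝ] (Fin r → ℝ)} {lo hi : Fin m → ℝ → ℝ}
  {Y : Matrix (Fin n) (Fin n) ℝ} {g : Fin n → Control m}

theorem exists_feasiblePf_forall_inner_nonneg
    (hmem : ∀ u, u ∈ affineSet A B φ ↔ (fun j => inner ℝ (g j) u) ∈ boundarySubspace Y φ)
    (hsurj : ∀ z, ∃ u : Control m, (fun j => inner ℝ (g j) u) = z) (hφ : ∃ z, φ z = 0)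
    (hlo : ∀ i, ContinuousOn (lo i) (Icc (0 : ℝ) 1))
    (hhi : ∀ i, ContinuousOn (hi i) (Icc (0 : ℝ) 1))
    (hlohi : ∀ i, ∀ t ∈ Icc (0 : ℝ) 1, lo i t < hi i t) :
    ∃ v uB, IsFeasiblePf A B φ lo hi v uB ∧
      ∀ w b, IsFeasiblePf A B φ lo hi w b → 0 ≤ inner ℝ v (w - v) := by
  set M : Control m →L[ℝ] (Fin n → ℝ) := ContinuousLinearMap.pi fun j => innerSL ℝ (g j)
  set S := boundarySubspace Y φ
  have hD : ∀ w b, IsFeasiblePf A B φ lo hi w b ↔ b ∈ box lo hi ∧ M (w + b) ∈ (S : Set _) :=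
    fun w b => and_comm.trans (and_congr_right fun _ => hmem (w + b))
  have hcl := isClosed_preimage_sub M S.closed_of_finiteDimensional (isClosed_box (lo := lo)
    (hi := hi)) convex_box (isBounded_box hlo hhi)
  have hcv : Convex ℝ {w : Control m | ∃ b ∈ box lo hi, M (w + b) ∈ (S : Set _)} := by
    rintro w ⟨b, hb, hw⟩ w' ⟨b', hb', hw'⟩ s t hs ht hst
    refine ⟨_, convex_box hb hb' hs ht hst, ?_⟩
    have : M (s • w + t • w' + (s • b + t • b')) = s • M (w + b) + t • M (w' + b') := by
      simp only [map_add, map_smul, smul_add]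
      abel
    rw [this]
    exact S.convex hw hw' hs ht hst
  have hne : {w : Control m | ∃ b ∈ box lo hi, M (w + b) ∈ (S : Set _)}.Nonempty := by
    obtain ⟨b, hb⟩ := box_nonempty hlo hlohi
    obtain ⟨z, hz⟩ := hφ
    obtain ⟨u, hu⟩ := hsurj (Yᵀ *ᵥ z.2 - z.1)
    refine ⟨u - b, b, hb, ?_⟩
    rw [sub_add_cancel]
    exact mem_boundarySubspace.2 ⟨z, hz, hu.symm⟩
  obtain ⟨v, ⟨uB, huB, hv⟩, hmin⟩ := exists_mem_forall_inner_nonneg hne hcl hcv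
  exact ⟨v, uB, (hD v uB).2 ⟨huB, hv⟩, fun w b hw => hmin w ⟨b, (hD w b).1 hw⟩⟩

theorem isSolutionPf_of_forall_inner_nonneg {v uB : Control m}
    (hv : IsFeasiblePf A B φ lo hi v uB)
    (hmin : ∀ w b, IsFeasiblePf A B φ lo hi w b → 0 ≤ inner ℝ v (w - v)) :
    IsSolutionPf A B φ lo hi v uB := by
  refine ⟨hv, fun w b hw => ?_⟩
  have := norm_sub_sq_le_of_inner_nonneg (hmin w b hw)
  rw [costPf_eq, costPf_eq]
  linarith [sq_nonneg ‖w - v‖]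

theorem IsSolutionPf.eq_of_forall_inner_nonneg {v uB w b : Control m}
    (hw : IsSolutionPf A B φ lo hi w b) (hv : IsFeasiblePf A B φ lo hi v uB)
    (hmin : ∀ w b, IsFeasiblePf A B φ lo hi w b → 0 ≤ inner ℝ v (w - v)) : w = v := by
  have h1 := norm_sub_sq_le_of_inner_nonneg (hmin w b hw.1)
  have h2 := hw.2 v uB hv
  rw [costPf_eq, costPf_eq] at h2
  have h3 : ‖w - v‖ ^ 2 = 0 := le_antisymm (by linarith) (sq_nonneg _)
  exact sub_eq_zero.1 (norm_eq_zero.1 (pow_eq_zero_iff two_ne_zero |>.1 h3))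

/-- Moving `v` by `±k` with `uB` fixed does not change the boundary values, so both signs are
feasible. -/
theorem inner_eq_zero_of_forall_inner_nonneg {v uB : Control m}
    (hmem : ∀ u, u ∈ affineSet A B φ ↔ (fun j => inner ℝ (g j) u) ∈ boundarySubspace Y φ)
    (hv : IsFeasiblePf A B φ lo hi v uB)
    (hmin : ∀ w b, IsFeasiblePf A B φ lo hi w b → 0 ≤ inner ℝ v (w - v)) {k : Control m}
    (hk : ∀ j, inner ℝ (g j) k = 0) : inner ℝ v k = 0 := by
  have hfeas : ∀ s : ℝ, IsFeasiblePf A B φ lo hi (v + s • k) uB := by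
    intro s
    refine ⟨?_, hv.2⟩
    have := (hmem _).1 hv.1
    rw [hmem]
    convert this using 2 with j
    simp [inner_add_right, inner_smul_right, hk j]
  have h1 := hmin _ _ (hfeas 1)
  have h2 := hmin _ _ (hfeas (-1))
  rw [add_sub_cancel_left, inner_smul_right] at h1 h2
  linarith

end Problem

end BestApprox

/-! ### Assembly of the theorem. -/

open BestApprox

theorem mainTheorem1 {n m r : ℕ}
    (A : ℝ → Matrix (Fin n) (Fin n) ℝ) (B : ℝ → Matrix (Fin n) (Fin m) ℝ)
    (hA : ContinuousOn A (Icc (0 : ℝ) 1)) (hB : ContinuousOn B (Icc (0 : ℝ) 1))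
    (φ : ((Fin n → ℝ) × (Fin n → ℝ)) →ᵃ[ℝ] (Fin r → ℝ))
    (hφ : ∃ z, φ z = 0)
    (lo hi : Fin m → ℝ → ℝ)
    (hlo : ∀ i, ContinuousOn (lo i) (Icc (0 : ℝ) 1))
    (hhi : ∀ i, ContinuousOn (hi i) (Icc (0 : ℝ) 1))
    (hlohi : ∀ i, ∀ t ∈ Icc (0 : ℝ) 1, lo i t < hi i t)
    (hctrl : BestApprox.ControllableOn A B 0 1)
    (hdisj : BestApprox.affineSet A B φ ∩ BestApprox.box lo hi = ∅) :
    (∃! v : BestApprox.Control m, ∃ uB : BestApprox.Control m,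
      BestApprox.IsSolutionPf A B φ lo hi v uB) ∧
    ∀ v uB : BestApprox.Control m, BestApprox.IsSolutionPf A B φ lo hi v uB →
      (∃ p : ℝ → Fin n → ℝ, BestApprox.SolvesAdjoint A p ∧
        ∀ᵐ t ∂(volume : Measure ℝ).restrict (Icc (0 : ℝ) 1),
          WithLp.ofLp (v t) = -((B t)ᵀ *ᵥ p t)) ∧
      ∀ i : Fin m,
        (∀ s₀ s₁ : ℝ, 0 ≤ s₀ → s₀ < s₁ → s₁ ≤ 1 →
          BestApprox.ControllableWrtOn A B i s₀ s₁) →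
        ((∀ᵐ t ∂(volume : Measure ℝ).restrict (Icc (0 : ℝ) 1),
            (0 < v t i → uB t i = hi i t) ∧ (v t i < 0 → uB t i = lo i t)) ∧
          (∀ s₀ s₁ : ℝ, 0 ≤ s₀ → s₀ < s₁ → s₁ ≤ 1 →
            ¬ ∀ᵐ t ∂(volume : Measure ℝ).restrict (Icc s₀ s₁), v t i = 0)) ∧
        ((∀ j k, AnalyticOn ℝ (fun t => A t j k) (Icc (0 : ℝ) 1)) →
          (∀ j k, AnalyticOn ℝ (fun t => B t j k) (Icc (0 : ℝ) 1)) →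
          ∀ᵐ t ∂(volume : Measure ℝ).restrict (Icc (0 : ℝ) 1),
            v t i ≠ 0 ∧
            (0 ≤ v t i → uB t i = hi i t) ∧ (v t i < 0 → uB t i = lo i t)) := by

  obtain ⟨X, Y, hX0, hY0, hXc, hYc, hX, hY, hYX⟩ := exists_fundamentalMatrices hA
  obtain ⟨g, hg⟩ := exists_isAdjointOutput hB hYc
  have hmem : ∀ u, u ∈ affineSet A B φ ↔
      (fun j => inner ℝ (g j) u) ∈ boundarySubspace (Y 1) φ := fun u => by
    rw [mem_boundarySubspace]
    exact hg.mem_affineSet_iff hA hB hXc hYc hX hY hYX hX0 hY0 φ u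
  obtain ⟨v₀, b₀, hfeas, hmin⟩ := exists_feasiblePf_forall_inner_nonneg hmem
    (hg.exists_inner_eq hA hB hYc hY hY0 hctrl) hφ hlo hhi hlohi
  have huniq : ∀ v uB, IsSolutionPf A B φ lo hi v uB → v = v₀ := fun v uB hv =>
    hv.eq_of_forall_inner_nonneg hfeas hmin
  refine ⟨⟨v₀, ⟨b₀, isSolutionPf_of_forall_inner_nonneg hfeas hmin⟩,
    fun v ⟨uB, hv⟩ => huniq v uB hv⟩, fun v uB hv => ?_⟩
  -- The variational inequality `hmin` involves only the gap vector, so it serves every solution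
  -- `(v, uB)`, whatever its `uB`.
  obtain rfl := huniq v uB hv
  obtain ⟨c, hc⟩ := hg.exists_of_forall_inner_eq_zero fun k hk =>
    inner_eq_zero_of_forall_inner_nonneg hmem hfeas hmin hk
  have hv0 : v ≠ 0 := by
    rintro rfl
    have h := hv.1
    rw [IsFeasiblePf, zero_add] at h
    exact eq_empty_iff_forall_notMem.1 hdisj uB h
  have hc0 : c ≠ 0 := by
    rintro rfl
    refine hv0 (Lp.ext ?_)
    filter_upwards [hc, Lp.coeFn_zero (EuclideanSpace ℝ (Fin m)) 2
      ((volume : Measure ℝ).restrict (Icc (0 : ℝ) 1))] with t h1 h2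
    rw [h2]
    rw [Matrix.mulVec_zero, Matrix.mulVec_zero] at h1
    exact (WithLp.ofLp_eq_zero 2).1 h1
  have hvi : ∀ i, ∀ᵐ t ∂(volume : Measure ℝ).restrict (Icc (0 : ℝ) 1),
      v t i = ((B t)ᵀ *ᵥ (Y t *ᵥ c)) i := fun i => hc.mono fun t ht => congrFun ht i
  refine ⟨⟨fun t => Y t *ᵥ (-c), fun t ht => (hY t ht (-c)).hasDerivWithinAt, ?_⟩,
    fun i hi_ctrl => ?_⟩
  · filter_upwards [hc] with t ht
    rw [ht, Matrix.mulVec_neg, Matrix.mulVec_neg, neg_neg]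
  -- The competitor `(v + uB - w, w)` has the same sum as `(v, uB)`, hence is feasible.
  have hbang := bang_of_forall_inner_nonneg hlo hhi hlohi hv.1.2 (fun w hw => by
    have := hmin (v + uB - w) w ⟨by rw [sub_add_cancel]; exact hv.1.1, hw⟩
    rwa [add_sub_assoc, add_sub_cancel_left] at this) i
  have hsing : ∀ s₀ s₁ : ℝ, 0 ≤ s₀ → s₀ < s₁ → s₁ ≤ 1 →
      ¬ ∀ t ∈ Icc s₀ s₁, ((B t)ᵀ *ᵥ (Y t *ᵥ c)) i = 0 := fun s₀ s₁ h0 h01 h1 h =>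
    hc0 (eq_zero_of_controllableWrtOn hY hYX h0 h01 h1 (hi_ctrl s₀ s₁ h0 h01 h1) h)
  refine ⟨⟨hbang, fun s₀ s₁ h0 h01 h1 h => hsing s₀ s₁ h0 h01 h1 ?_⟩, fun hAan hBan => ?_⟩
  · have hsub : Icc s₀ s₁ ⊆ Icc (0 : ℝ) 1 := Icc_subset_Icc h0 h1
    have hcont : ContinuousOn (fun t => ((B t)ᵀ *ᵥ (Y t *ᵥ c)) i) (Icc s₀ s₁) :=
      continuousOn_pi.1 (continuousOn_mulVec
        (continuous_id.matrix_transpose.comp_continuousOn (hB.mono hsub))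
        (hYc c).continuous.continuousOn) i
    -- Continuity of the representative upgrades vanishing a.e. to vanishing everywhere on the
    -- interval.
    refine Measure.eqOn_Icc_of_ae_eq volume h01.ne ?_ hcont continuousOn_const
    filter_upwards [h, ae_restrict_of_ae_restrict_of_subset hsub (hvi i)] with t h2 h3
    rw [← h3, h2]
  · have hne : ∀ᵐ t ∂(volume : Measure ℝ).restrict (Icc (0 : ℝ) 1),
        ((B t)ᵀ *ᵥ (Y t *ᵥ c)) i ≠ 0 := by
      by_contra h
      obtain ⟨s₀, s₁, h0, h01, h1, hz⟩ := exists_Icc_eq_zero_of_analyticOn hAan hBan hX hYX h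
      exact hsing s₀ s₁ h0 h01 h1 hz
    filter_upwards [hne, hvi i, hbang] with t h1 h2 h3
    have hne' : v t i ≠ 0 := h2 ▸ h1
    exact ⟨hne', fun h => h3.1 (lt_of_le_of_ne h hne'.symm), h3.2⟩
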